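/- Let $d\ge 1$, $m>0$, $\sigma\ge 0$. Let $\Gamma_0=\bigsqcup_{n\ge 0}\Gamma^{(n)}$ be the space of finite subsets (configurations) of $\mathbb R^d$, where $\Gamma^{(n)}$ is the set of $n$-point subsets, with its Borel $\sigma$-algebra, and let $\lambda=\sum_{n\ge 0}\frac1{n!}\mathrm m^{(n)}$ be the Lebesgue–Poisson measure, where $\mathrm m^{(n)}$ is the image on $\Gamma^{(n)}$ of the Lebesgue measure on the $n$-tuples of distinct points of $\mathbb R^d$. For $f:\mathbb R^d\to\mathbb R$ put $e_\lambda(f,\eta)=\prod_{x\in\eta}f(x)$, $e_\lambda(f,\emptyset)=1$. For $C>0$ let $\mathcal L_C$ be the Banach space of (classes of $\lambda$-a.e. equal) measurable functions $G$ on $\Gamma_0$, real- or complex-valued, with $\|G\|_C=\int_{\Gamma_0}|G(\eta)|C^{|\eta|}\,d\lambda(\eta)<\infty$. Let $C>0$ and $C\ge\sigma/m$. Then the formula $$(\hat LG)(\eta)=-m|\eta|G(\eta)+\sigma\int_{\mathbb R^d}G(\eta\cup x)\,dx$$ defines a linear, densely defined, closable operator in $\mathcal L_C$ with domain $\mathcal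 L_{2C}$, and its closure $(\hat L,D(\hat L))$ is the generator of exactly one strongly continuous semigroup $(\hat T(t))_{t\ge 0}$ on $\mathcal L_C$. This semigroup is contractive, and for all $t\ge 0$ and $G\in\mathcal L_C$, for $\lambda$-a.e. $\eta$ (the integrand being $\lambda$-integrable in $\xi$), $$(\hat T(t)G)(\eta)=e^{-tm|\eta|}\int_{\Gamma_0}G(\eta\cup\xi)\,e_\lambda\Bigl(\frac{\sigma}{m}(1-e^{-tm}),\xi\Bigr)\,d\lambda(\xi).$$ Moreover, on the complex space $\mathcal L_C$, for every $z\in\mathbb C$ with $\operatorname{Re}z>0$ the bounded resolvent operator $R_z=(z-\hat L)^{-1}$ exists, and for all $G\in\mathcal L_C$, for $\lambda$-a.e. $\eta$ (the integrand being $\lambda$-integrable in $\xi$), $$(R_zG)(\eta)=\frac1m\int_{\Gamma_0}G(\eta\cup\xi)\Bigl(\frac{\sigma}{m}\Bigr)^{|\xi|}B\Bigl(\frac zm+|\eta|,|\xi|+1\Bigr)\,d\lambda(\xi),$$ where $B(x,y)=\int_0^1s^{x-1}(1-s)^{y-1}\,ds$ is the Euler beta function. -/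

import Mathlib

open MeasureTheory Filter Topology
open scoped NNReal ENNReal

noncomputable section

/-- A point of the space `Γ₀` of finite configurations in `ℝᵈ`: a finite subset of `ℝᵈ`. -/
@[ext]
structure FinConf (d : ℕ) where
  /-- the underlying finite set of points -/
  points : Finset (EuclideanSpace ℝ (Fin d))

namespace FinConf

variable {d : ℕ}

/-- The number `|η|` of points of `η`. -/
def card (η : FinConf d) : ℕ := η.points.card

open scoped Classical in
instance : Union (FinConf d) := ⟨fun η ξ => ⟨η.points ∪ ξ.points⟩⟩

instance : Singleton (EuclideanSpace ℝ (Fin d)) (FinConf d) := ⟨fun x => ⟨{x}⟩⟩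

/-- The configuration `{x₁, …, xₙ}` of an `n`-tuple of pairwise distinct points. -/
def ofTuple (n : ℕ)
    (x : {x : Fin n → EuclideanSpace ℝ (Fin d) // Function.Injective x}) : FinConf d :=
  ⟨Finset.univ.map ⟨x.1, x.2⟩⟩

/-- The Borel σ-algebra of `Γ₀ = ⨆ₙ Γ⁽ⁿ⁾` (disjoint union), where `Γ⁽ⁿ⁾` is the quotient of the
tuples of `n` distinct points by permutations: a set is measurable iff for every `n` the set of the
tuples of `n` distinct points whose configuration belongs to it is a Borel set. -/
instance : MeasurableSpace (FinConf d) :=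
  ⨅ n : ℕ, MeasurableSpace.map (ofTuple n) inferInstance

/-- `m⁽ⁿ⁾`: the image on `Γ⁽ⁿ⁾` of the `n`-fold product of Lebesgue measure. -/
def lebesgueN (d n : ℕ) : Measure (FinConf d) :=
  Measure.map (ofTuple n)
    (Measure.comap Subtype.val (volume : Measure (Fin n → EuclideanSpace ℝ (Fin d))))

/-- The Lebesgue–Poisson measure `λ = ∑ₙ (1 / n!) m⁽ⁿ⁾` on `Γ₀`. -/
def lebesguePoisson (d : ℕ) : Measure (FinConf d) :=
  Measure.sum fun n : ℕ => ((n.factorial : ℝ≥0∞)⁻¹) • lebesgueN d n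

/-- The measure `C^{|η|} dλ(η)`. -/
def lebesguePoissonC (d : ℕ) (C : ℝ) : Measure (FinConf d) :=
  (lebesguePoisson d).withDensity fun η => ENNReal.ofReal (C ^ η.card)

/-- The coherent state `e_λ(f, η) = ∏_{x ∈ η} f x` (equal to `1` for `η = ∅`). -/
def coherent (f : EuclideanSpace ℝ (Fin d) → ℝ) (η : FinConf d) : ℝ := ∏ x ∈ η.points, f x

end FinConf

/-- The Banach space `L_C` of (classes of) functions `G` on `Γ₀` with
`‖G‖_C = ∫ |G(η)| C^{|η|} dλ(η) < ∞`. -/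
abbrev SpaceLC (𝕜 : Type*) [RCLike 𝕜] (d : ℕ) (C : ℝ) : Type _ :=
  Lp 𝕜 1 (FinConf.lebesguePoissonC d C)

/-- The expression `(L̂ G)(η) = -m |η| G(η) + σ ∫ G(η ∪ x) dx`. -/
def hatLFun {𝕜 : Type*} [RCLike 𝕜] {d : ℕ} (m σ : ℝ) (G : FinConf d → 𝕜) (η : FinConf d) : 𝕜 :=
  -(m * (η.card : ℝ)) • G η + σ • ∫ x : EuclideanSpace ℝ (Fin d), G (η ∪ {x})

/-- The graph of `L̂` on `L_{2C}` as an operator in `L_C`: the pairs of the class of a function `g`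
in `L_{2C}` and the class of the function `L̂ g`. -/
def hatLGraph (𝕜 : Type*) [RCLike 𝕜] (d : ℕ) (m σ C : ℝ) :
    Submodule 𝕜 (SpaceLC 𝕜 d C × SpaceLC 𝕜 d C) where
  carrier := {p | ∃ g : FinConf d → 𝕜,
    MemLp g 1 (FinConf.lebesguePoissonC d (2 * C)) ∧
    p.1 =ᵐ[FinConf.lebesguePoissonC d C] g ∧
    (∀ᵐ η ∂(FinConf.lebesguePoissonC d C),
      Integrable fun x : EuclideanSpace ℝ (Fin d) => g (η ∪ {x})) ∧
    p.2 =ᵐ[FinConf.lebesguePoissonC d C] hatLFun m σ g}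
  zero_mem' := by
    refine ⟨0, MemLp.zero, Lp.coeFn_zero _ _ _, .of_forall fun η => integrable_zero _ _ _, ?_⟩
    filter_upwards [Lp.coeFn_zero 𝕜 1 (FinConf.lebesguePoissonC d C)] with η hη
    simpa [hatLFun] using hη
  add_mem' := by
    rintro p q ⟨g, hg, hpg, hgi, hgL⟩ ⟨k, hk, hqk, hki, hkL⟩
    refine ⟨g + k, hg.add hk, (Lp.coeFn_add _ _).trans (hpg.add hqk), ?_, ?_⟩
    · filter_upwards [hgi, hki] with η h₁ h₂ using h₁.add h₂
    · filter_upwards [Lp.coeFn_add p.2 q.2, hgi, hki, hgL, hkL] with η h h₁ h₂ h₃ h₄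
      have e : (p + q).2 η = p.2 η + q.2 η := h
      rw [e, h₃, h₄]
      simp only [hatLFun, Pi.add_apply]
      rw [integral_add h₁ h₂]
      module
  smul_mem' := by
    rintro c p ⟨g, hg, hpg, hgi, hgL⟩
    refine ⟨c • g, hg.const_smul c, (Lp.coeFn_smul _ _).trans (hpg.const_smul c), ?_, ?_⟩
    · filter_upwards [hgi] with η h₁ using h₁.smul c
    · filter_upwards [Lp.coeFn_smul c p.2, hgi, hgL] with η h h₁ h₃
      have e : (c • p).2 η = c • p.2 η := h
      rw [e, h₃]
      simp only [hatLFun, Pi.smul_apply]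
      rw [integral_smul, smul_add, smul_comm c, smul_comm c]

/-- The operator `(L̂, L_{2C})` in `L_C`. -/
def hatL (𝕜 : Type*) [RCLike 𝕜] (d : ℕ) (m σ C : ℝ) :
    SpaceLC 𝕜 d C →ₗ.[𝕜] SpaceLC 𝕜 d C :=
  (hatLGraph 𝕜 d m σ C).toLinearPMap

section Semigroup

variable {𝕜 E : Type*} [RCLike 𝕜] [NormedAddCommGroup E] [NormedSpace 𝕜 E]

/-- Strongly continuous semigroups of bounded linear operators. -/
structure IsC0Semigroup (T : ℝ≥0 → E →L[𝕜] E) : Prop where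
  zero : T 0 = ContinuousLinearMap.id 𝕜 E
  add : ∀ s t : ℝ≥0, T (s + t) = (T s).comp (T t)
  continuous : ∀ x : E, Continuous fun t : ℝ≥0 => T t x

/-- The graph of the generator of `T`: the pairs `(x, y)` with `(T t x - x) / t → y` as `t ↓ 0`. -/
def generatorGraph (T : ℝ≥0 → E →L[𝕜] E) : Submodule 𝕜 (E × E) where
  carrier := {p | Tendsto (fun t : ℝ≥0 => (((t : ℝ) : 𝕜)⁻¹) • (T t p.1 - p.1)) (𝓝[>] 0) (𝓝 p.2)}
  zero_mem' := by simp
  add_mem' := by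
    intro p q hp hq
    refine (Tendsto.add hp hq).congr fun t => ?_
    simp only [Prod.fst_add, map_add]
    module
  smul_mem' := by
    intro c p hp
    refine (Tendsto.const_smul hp c).congr fun t => ?_
    simp only [Prod.smul_fst, map_smul]
    module

/-- The generator of `T`. -/
def generator (T : ℝ≥0 → E →L[𝕜] E) : E →ₗ.[𝕜] E := (generatorGraph T).toLinearPMap

theorem generator_graph (T : ℝ≥0 → E →L[𝕜] E) : (generator T).graph = generatorGraph T := by
  refine Submodule.toLinearPMap_graph_eq _ fun p hp h0 => ?_
  have h : Tendsto (fun t : ℝ≥0 => (((t : ℝ) : 𝕜)⁻¹) • (T t p.1 - p.1)) (𝓝[>] 0) (𝓝 p.2) := hp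
  simp only [h0, map_zero, sub_zero, smul_zero] at h
  exact tendsto_nhds_unique h tendsto_const_nhds

/-- `R` is the bounded resolvent operator `(z - A)⁻¹` of the operator `A`. -/
def IsResolvent (A : E →ₗ.[𝕜] E) (z : 𝕜) (R : E →L[𝕜] E) : Prop :=
  (∀ y : E, ∃ h : R y ∈ A.domain, z • R y - A ⟨R y, h⟩ = y) ∧
    ∀ x : A.domain, R (z • (x : E) - A x) = x

end Semigroup

end

/-!
The operator `L̂`, its semigroup and its resolvent are all integral operators of one kind. For a
kernel `a : ℕ → ℕ → 𝕜` put `(K_a G)(η) = ∫ a(|η|, |ξ|) G(η ∪ ξ) dλ(ξ)` (`FinConf.kerOp`). The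
Lebesgue–Poisson measure satisfies
`∫∫ h(|ξ|, |ζ|) F(ξ ∪ ζ) dλ(ξ) dλ(ζ) = ∫ F(ω) ∑_{k + l = |ω|} (|ω| choose k) h(k, l) dλ(ω)`
(`lintegral_union`, `integral_union`), because a configuration of `n` points splits into `k` points
and the remaining ones in `n choose k` ways. Hence everything reduces to binomial sums.

* `‖K_a G‖_C ≤ ∫ |G(ω)| w(|ω|) dλ(ω)` with `w(N) = ∑_{k + l = N} (N choose k) |a(k, l)| C^k`
  (`eLpNorm_kerOp_le`); together with dominated convergence (`tendsto_zero_of_coe_eq_kerOp`) this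
  gives boundedness, strong continuity and the density of `L_{2C}`.
* `K_a K_b = K_c` with `c(k, l) = ∑_{i + j = l} (l choose i) a(k, i) b(k + i, j)` (`kerOp_kerOp`),
  which turns the semigroup law and the resolvent identities into identities of kernels.

The kernel of `L̂` is `-m k` at `l = 0` and `σ` at `l = 1`. The kernel
`e^{-tmk} (σ/m (1 - e^{-tm}))^l` satisfies the semigroup law by the binomial theorem, has the weight
`w(N) = (e^{-tm} C + (1 - e^{-tm}) σ/m)^N ≤ C^N`, and has the kernel of `L̂` as derivative at `t = 0`.
The kernel `r(k, l) = σ^l l! / ∏_{j ≤ l} (z + m (k + j))`, which is the beta function kernel of the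
statement, satisfies `(z + m k) r(k, l) = σ l r(k + 1, l - 1)` and
`(z + m (k + l)) r(k, l) = σ l r(k, l - 1)` for `l ≥ 1`; these recurrences say that it inverts
`z - L̂` from both sides, and the first one also yields its weight bound `C^N / Re z`.

`L̂` is closable because `2^{-|η|} L̂` is bounded on `L_C`. By density `K_r` is the resolvent of the
closure of `L̂` (`isResolvent_closure`). The generator of `T̂` is a closed extension of `L̂`, and `z`
minus this generator is injective since `T̂` is contractive, so it coincides with the closure of `L̂`
(`IsC0Semigroup.generator_eq_closure`). Uniqueness of the semigroup is a differential inequality for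
the distance of two orbits (`IsC0Semigroup.eq_of_generatorGraph_eq`).
-/

noncomputable section

/-! ### Configurations and tuples -/

namespace FinConf

variable {d : ℕ}

theorem measurable_ofTuple (n : ℕ) : Measurable (ofTuple (d := d) n) :=
  measurable_iff_le_map.2 (iInf_le _ n)

theorem measurable_of_comp_ofTuple {β : Type*} [MeasurableSpace β] {f : FinConf d → β}
    (h : ∀ n, Measurable (f ∘ ofTuple n)) : Measurable f := fun _ hs =>
  MeasurableSpace.measurableSet_iInf.2 fun n => h n hs

theorem card_ofTuple (n : ℕ)
    (x : {x : Fin n → EuclideanSpace ℝ (Fin d) // Function.Injective x}) :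
    (ofTuple n x).card = n := by
  simp [ofTuple, card]

theorem measurable_card : Measurable (card : FinConf d → ℕ) :=
  measurable_of_comp_ofTuple fun n => by
    have : card ∘ ofTuple (d := d) n = fun _ => n := funext (card_ofTuple n)
    rw [this]; exact measurable_const

theorem measurableSet_injective (n : ℕ) :
    MeasurableSet {x : Fin n → EuclideanSpace ℝ (Fin d) | Function.Injective x} := by
  simp only [Function.Injective, Set.ofPred_forall]
  refine .iInter fun i => .iInter fun j => ?_
  by_cases h : i = j
  · simp [h]
  · simp only [h, imp_false]
    exact (measurableSet_eq_fun (measurable_pi_apply i) (measurable_pi_apply j)).compl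

/-- In positive dimension the coincidence sets `x i = x j` are proper subspaces. -/
theorem ae_injective [NeZero d] (n : ℕ) :
    ∀ᵐ x : Fin n → EuclideanSpace ℝ (Fin d), Function.Injective x := by
  have h : ∀ i j : Fin n, i ≠ j → ∀ᵐ x : Fin n → EuclideanSpace ℝ (Fin d), x i ≠ x j := by
    intro i j hij
    let p : (Fin n → EuclideanSpace ℝ (Fin d)) →ₗ[ℝ] EuclideanSpace ℝ (Fin d) :=
      LinearMap.proj (R := ℝ) (φ := fun _ : Fin n => EuclideanSpace ℝ (Fin d)) i -
        LinearMap.proj j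
    have hp : LinearMap.ker p ≠ ⊤ := by
      intro h
      have : Pi.single i (EuclideanSpace.single (0 : Fin d) (1 : ℝ)) ∈ LinearMap.ker p := by
        rw [h]; trivial
      simp [p, hij.symm] at this
    have h0 := Measure.addHaar_submodule
      (volume : Measure (Fin n → EuclideanSpace ℝ (Fin d))) _ hp
    rw [ae_iff]
    convert h0 using 2
    ext x
    simp [p, sub_eq_zero]
  have h' : ∀ᵐ x : Fin n → EuclideanSpace ℝ (Fin d), ∀ i j : Fin n, i ≠ j → x i ≠ x j := by
    simp only [ae_all_iff]
    exact fun i j hij => h i j hij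
  filter_upwards [h'] with x hx i j hij
  by_contra hne
  exact hx i j hne hij

open scoped Classical in
/-- The configuration of the entries of a tuple of `n` distinct points, extended to the other tuples
by the empty configuration. -/
def tuple (n : ℕ) (x : Fin n → EuclideanSpace ℝ (Fin d)) : FinConf d :=
  if h : Function.Injective x then ofTuple n ⟨x, h⟩ else ⟨∅⟩

theorem tuple_of_injective {n : ℕ} {x : Fin n → EuclideanSpace ℝ (Fin d)}
    (h : Function.Injective x) : tuple n x = ofTuple n ⟨x, h⟩ := dif_pos h

theorem measurable_tuple (n : ℕ) : Measurable (tuple (d := d) n) := by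
  classical
  have := Measurable.dite (s := {x : Fin n → EuclideanSpace ℝ (Fin d) | Function.Injective x})
    (f := ofTuple n) (g := fun _ => ⟨∅⟩) (measurable_ofTuple n) measurable_const
    (measurableSet_injective n)
  convert this using 2 with x
  by_cases h : Function.Injective x <;> simp [tuple, h]

/-- Tuples with coinciding entries form a null set, so `m⁽ⁿ⁾` is the image of the Lebesgue measure on
all tuples. -/
theorem lebesgueN_eq [NeZero d] (n : ℕ) : lebesgueN d n = volume.map (tuple n) := by
  have h1 : (ofTuple n : _ → FinConf d) = tuple n ∘ Subtype.val := by
    funext x; exact (tuple_of_injective x.2).symm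
  have h2 := (MeasurableEmbedding.subtype_coe (measurableSet_injective (d := d) n)).map_comap volume
  unfold lebesgueN
  rw [h1, ← Measure.map_map (measurable_tuple n) measurable_subtype_coe]
  erw [h2]
  rw [Subtype.range_coe_subtype, Measure.restrict_eq_self_of_ae_mem]
  exact ae_injective n

theorem tuple_comp_perm {n : ℕ} (x : Fin n → EuclideanSpace ℝ (Fin d)) (π : Equiv.Perm (Fin n)) :
    tuple n (x ∘ π) = tuple n x := by
  by_cases h : Function.Injective x
  · rw [tuple_of_injective h, tuple_of_injective (h.comp π.injective)]
    ext y
    simp only [ofTuple, Finset.mem_map, Finset.mem_univ, true_and, Function.Embedding.coeFn_mk,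
      Function.comp_apply]
    exact ⟨fun ⟨a, ha⟩ => ⟨π a, ha⟩, fun ⟨a, ha⟩ => ⟨π.symm a, by simpa using ha⟩⟩
  · have h' : ¬ Function.Injective (x ∘ π) := fun h' => h <| by
      simpa [Function.comp_assoc] using h'.comp π.symm.injective
    rw [tuple, dif_neg h', tuple, dif_neg h]

/-- A measurable injection of `ℝᵈ` into `ℝ`, used to order the points of a configuration. -/
def key : EuclideanSpace ℝ (Fin d) → ℝ := embeddingReal _

theorem measurable_key : Measurable (key (d := d)) := measurable_embeddingReal _

theorem key_injective : Function.Injective (key (d := d)) :=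
  (measurableEmbedding_embeddingReal _).injective

theorem injective_of_strictMono_key {n : ℕ} {x : Fin n → EuclideanSpace ℝ (Fin d)}
    (h : StrictMono (key ∘ x)) : Function.Injective x := h.injective.of_comp

theorem exists_perm_strictMono_key {n : ℕ} {x : Fin n → EuclideanSpace ℝ (Fin d)}
    (hx : Function.Injective x) : ∃ π : Equiv.Perm (Fin n), StrictMono (key ∘ x ∘ π) :=
  ⟨Tuple.sort (key ∘ x), (Tuple.monotone_sort (key ∘ x)).strictMono_of_injective
    ((key_injective.comp hx).comp (Equiv.injective _))⟩

theorem exists_strictMono_tuple (η : FinConf d) {n : ℕ} (h : η.card = n) :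
    ∃ x : Fin n → EuclideanSpace ℝ (Fin d), StrictMono (key ∘ x) ∧ tuple n x = η := by
  let e := η.points.equivFinOfCardEq h
  let y : Fin n → EuclideanSpace ℝ (Fin d) := fun i => e.symm i
  have hy : Function.Injective y := Subtype.val_injective.comp e.symm.injective
  obtain ⟨π, hπ⟩ := exists_perm_strictMono_key hy
  refine ⟨y ∘ π, hπ, ?_⟩
  rw [tuple_comp_perm, tuple_of_injective hy]
  ext z
  simp only [ofTuple, Finset.mem_map, Finset.mem_univ, true_and, Function.Embedding.coeFn_mk]
  exact ⟨fun ⟨a, ha⟩ => ha ▸ (e.symm a).2, fun hz => ⟨e ⟨z, hz⟩, by simp [y]⟩⟩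

theorem points_tuple {n : ℕ} {x : Fin n → EuclideanSpace ℝ (Fin d)} (h : Function.Injective x) :
    ((tuple n x).points : Set (EuclideanSpace ℝ (Fin d))) = Set.range x := by
  rw [tuple_of_injective h]; ext; simp [ofTuple]

theorem card_tuple {n : ℕ} {x : Fin n → EuclideanSpace ℝ (Fin d)} (h : Function.Injective x) :
    (tuple n x).card = n := by rw [tuple_of_injective h, card_ofTuple]

theorem tuple_injOn_strictMono {n : ℕ} {x y : Fin n → EuclideanSpace ℝ (Fin d)}
    (hx : StrictMono (key ∘ x)) (hy : StrictMono (key ∘ y)) (h : tuple n x = tuple n y) :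
    x = y := by
  have h1 := points_tuple (injective_of_strictMono_key hx)
  rw [h, points_tuple (injective_of_strictMono_key hy)] at h1
  have h2 : key ∘ x = key ∘ y := (StrictMono.range_inj hx hy).1 (by rw [Set.range_comp, ← h1,
    Set.range_comp])
  exact key_injective.comp_left h2

open scoped Classical in
/-- The points of an `n`-point configuration in increasing order of `key`: a section of `tuple n`. -/
def sortedTuple (n : ℕ) (η : FinConf d) : Fin n → EuclideanSpace ℝ (Fin d) :=
  if h : η.card = n then (exists_strictMono_tuple η h).choose else 0

theorem sortedTuple_spec {n : ℕ} {η : FinConf d} (h : η.card = n) :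
    StrictMono (key ∘ sortedTuple n η) ∧ tuple n (sortedTuple n η) = η := by
  rw [sortedTuple, dif_pos h]
  exact (exists_strictMono_tuple η h).choose_spec

theorem sortedTuple_tuple {n : ℕ} {x : Fin n → EuclideanSpace ℝ (Fin d)} (π : Equiv.Perm (Fin n))
    (hπ : StrictMono (key ∘ x ∘ π)) : sortedTuple n (tuple n x) = x ∘ π := by
  have hx : Function.Injective x := by
    simpa [Function.comp_assoc] using
      (injective_of_strictMono_key hπ).comp π.symm.injective
  have := sortedTuple_spec (card_tuple hx)
  exact tuple_injOn_strictMono this.1 hπ (by rw [this.2, tuple_comp_perm])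

theorem measurableSet_strictMono_key {n : ℕ} (π : Equiv.Perm (Fin n)) :
    MeasurableSet {x : Fin n → EuclideanSpace ℝ (Fin d) | StrictMono (key ∘ x ∘ π)} := by
  simp only [StrictMono, Set.ofPred_forall]
  refine .iInter fun i => .iInter fun j => .iInter fun _ => ?_
  exact measurableSet_lt (measurable_key.comp (measurable_pi_apply _))
    (measurable_key.comp (measurable_pi_apply _))

theorem measurable_sortedTuple (n : ℕ) : Measurable (sortedTuple (d := d) n) := by
  refine measurable_of_comp_ofTuple fun k => ?_
  by_cases hk : k = n
  · subst hk
    intro s hs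
    have : sortedTuple k ∘ ofTuple k ⁻¹' s = Subtype.val ⁻¹' ⋃ π : Equiv.Perm (Fin k),
        {x : Fin k → EuclideanSpace ℝ (Fin d) | StrictMono (key ∘ x ∘ π)} ∩ {x | x ∘ π ∈ s} := by
      ext ⟨x, hx⟩
      simp only [Set.mem_preimage, Function.comp_apply, Set.mem_iUnion, Set.mem_inter_iff,
        Set.mem_ofPred_eq, ← tuple_of_injective hx]
      constructor
      · intro h
        obtain ⟨π, hπ⟩ := exists_perm_strictMono_key hx
        exact ⟨π, hπ, sortedTuple_tuple π hπ ▸ h⟩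
      · rintro ⟨π, hπ, h⟩
        rwa [sortedTuple_tuple π hπ]
    rw [this]
    refine measurable_subtype_coe (.iUnion fun π => (measurableSet_strictMono_key π).inter ?_)
    exact (measurable_pi_lambda _ fun i => measurable_pi_apply (π i)) hs
  · have : sortedTuple (d := d) n ∘ ofTuple k = fun _ => 0 := by
      funext x
      simp [sortedTuple, card_ofTuple, hk]
    rw [this]; exact measurable_const

/-- Concatenation of tuples preserves Lebesgue measure. -/
theorem measurePreserving_append (i j : ℕ) :
    MeasurePreserving (fun p : (Fin i → EuclideanSpace ℝ (Fin d)) ×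
      (Fin j → EuclideanSpace ℝ (Fin d)) => Fin.append p.1 p.2)
      (volume.prod volume) volume := by
  have h1 := volume_measurePreserving_sumPiEquivProdPi_symm
    (fun _ : Fin i ⊕ Fin j => EuclideanSpace ℝ (Fin d))
  have h2 := volume_measurePreserving_piCongrLeft
    (fun _ : Fin (i + j) => EuclideanSpace ℝ (Fin d)) finSumFinEquiv
  have h3 := h2.comp h1
  suffices h : (fun p : (Fin i → EuclideanSpace ℝ (Fin d)) × (Fin j → EuclideanSpace ℝ (Fin d)) =>
      Fin.append p.1 p.2) = (MeasurableEquiv.piCongrLeft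
        (fun _ : Fin (i + j) => EuclideanSpace ℝ (Fin d)) finSumFinEquiv) ∘
      (MeasurableEquiv.sumPiEquivProdPi
        (fun _ : Fin i ⊕ Fin j => EuclideanSpace ℝ (Fin d))).symm by
    rw [h]; exact h3
  funext p
  ext1 k
  refine Fin.addCases (fun a => ?_) (fun a => ?_) k
  · have := (MeasurableEquiv.piCongrLeft_apply_apply
      (β := fun _ : Fin (i + j) => EuclideanSpace ℝ (Fin d)) finSumFinEquiv
      ((MeasurableEquiv.sumPiEquivProdPi
        (fun _ : Fin i ⊕ Fin j => EuclideanSpace ℝ (Fin d))).symm p) (Sum.inl a))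
    simp only [finSumFinEquiv_apply_left] at this
    simp only [Fin.append_left]
    exact this.symm
  · have := (MeasurableEquiv.piCongrLeft_apply_apply
      (β := fun _ : Fin (i + j) => EuclideanSpace ℝ (Fin d)) finSumFinEquiv
      ((MeasurableEquiv.sumPiEquivProdPi
        (fun _ : Fin i ⊕ Fin j => EuclideanSpace ℝ (Fin d))).symm p) (Sum.inr a))
    simp only [finSumFinEquiv_apply_right] at this
    simp only [Fin.append_right]
    exact this.symm

theorem tuple_append {i j : ℕ} {x : Fin i → EuclideanSpace ℝ (Fin d)}
    {y : Fin j → EuclideanSpace ℝ (Fin d)} (h : Function.Injective (Fin.append x y)) :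
    tuple (i + j) (Fin.append x y) = tuple i x ∪ tuple j y := by
  classical
  obtain ⟨hx, hy, -⟩ := Fin.append_injective_iff.1 h
  have h3 : (tuple (i + j) (Fin.append x y)).points = (tuple i x).points ∪ (tuple j y).points := by
    apply Finset.coe_injective
    rw [points_tuple h, Finset.coe_union, points_tuple hx, points_tuple hy]
    ext z
    simp only [Set.mem_range, Set.mem_union]
    constructor
    · rintro ⟨k, rfl⟩
      refine Fin.addCases (fun a => ?_) (fun a => ?_) k
      · exact Or.inl ⟨a, by simp⟩
      · exact Or.inr ⟨a, by simp⟩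
    · rintro (⟨a, rfl⟩ | ⟨a, rfl⟩)
      · exact ⟨Fin.castAdd j a, by simp⟩
      · exact ⟨Fin.natAdd i a, by simp⟩
  ext z
  rw [h3]
  change _ ↔ z ∈ ((tuple i x).points ∪ (tuple j y).points : Finset _)
  congr!

end FinConf

/-! ### Unions of configurations with given numbers of points -/

namespace FinConf

variable {d : ℕ}

/-- The part of the Lebesgue–Poisson measure carried by the `n`-point configurations. -/
def slice (d n : ℕ) : Measure (FinConf d) := ((n.factorial : ℝ≥0∞)⁻¹) • lebesgueN d n

theorem lebesguePoisson_eq_sum (d : ℕ) :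
    lebesguePoisson d = Measure.sum (slice d) := rfl

instance [NeZero d] (n : ℕ) : SFinite (lebesgueN d n) := by
  rw [lebesgueN_eq]; infer_instance

instance [NeZero d] (n : ℕ) : SFinite (slice d n) := by
  unfold slice; infer_instance

instance [NeZero d] : SFinite (lebesguePoisson d) := by
  rw [lebesguePoisson_eq_sum]; infer_instance

instance [NeZero d] (C : ℝ) : SFinite (lebesguePoissonC d C) := by
  unfold lebesguePoissonC; infer_instance

theorem ae_slice_card [NeZero d] (n : ℕ) : ∀ᵐ η ∂slice d n, η.card = n := by
  refine Measure.ae_smul_measure ?_ _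
  rw [lebesgueN_eq]
  refine (ae_map_iff (measurable_tuple n).aemeasurable
    (measurable_card (measurableSet_singleton n))).2 ?_
  filter_upwards [ae_injective n] with x hx using card_tuple hx

/-- A measurable version of the union map on pairs of configurations of `i` and of `j` points. -/
def sortedUnion (i j : ℕ) (p : FinConf d × FinConf d) : FinConf d :=
  tuple (i + j) (Fin.append (sortedTuple i p.1) (sortedTuple j p.2))

theorem measurable_sortedAppend (i j : ℕ) : Measurable fun p : FinConf d × FinConf d =>
    Fin.append (sortedTuple i p.1) (sortedTuple j p.2) :=
  (measurePreserving_append i j).measurable.comp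
    (((measurable_sortedTuple i).comp measurable_fst).prodMk
      ((measurable_sortedTuple j).comp measurable_snd))

theorem measurable_sortedUnion (i j : ℕ) : Measurable (sortedUnion (d := d) i j) :=
  (measurable_tuple _).comp (measurable_sortedAppend i j)

section Union

variable [NeZero d] (i j : ℕ)

theorem lebesgueN_prod : (lebesgueN d i).prod (lebesgueN d j) =
    (volume.prod volume).map (Prod.map (tuple i) (tuple j)) := by
  rw [lebesgueN_eq, lebesgueN_eq,
    Measure.map_prod_map _ _ (measurable_tuple i) (measurable_tuple j)]

theorem ae_injective_append : ∀ᵐ p : (Fin i → EuclideanSpace ℝ (Fin d)) ×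
    (Fin j → EuclideanSpace ℝ (Fin d)) ∂(volume.prod volume),
    Function.Injective (Fin.append p.1 p.2) :=
  (measurePreserving_append i j).quasiMeasurePreserving.ae (ae_injective (i + j))

/-- Almost every pair consists of disjoint configurations, and for disjoint configurations the union
is the configuration of the concatenated tuples. This makes the union almost everywhere measurable
for the product σ-algebra. -/
theorem ae_sortedUnion : ∀ᵐ p ∂((lebesgueN d i).prod (lebesgueN d j)),
    p.1 ∪ p.2 = sortedUnion i j p := by
  have h : ∀ᵐ p ∂((lebesgueN d i).prod (lebesgueN d j)), p.1.card = i ∧ p.2.card = j ∧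
      Function.Injective (Fin.append (sortedTuple i p.1) (sortedTuple j p.2)) := by
    rw [lebesgueN_prod, ae_map_iff ((measurable_tuple i).prodMap (measurable_tuple j)).aemeasurable]
    · filter_upwards [ae_injective_append i j] with p hp
      obtain ⟨hx, hy, hxy⟩ := Fin.append_injective_iff.1 hp
      obtain ⟨π, hπ⟩ := exists_perm_strictMono_key hx
      obtain ⟨ρ, hρ⟩ := exists_perm_strictMono_key hy
      refine ⟨card_tuple hx, card_tuple hy, ?_⟩
      simp only [Prod.map_fst, Prod.map_snd]
      rw [sortedTuple_tuple π hπ, sortedTuple_tuple ρ hρ]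
      exact Fin.append_injective_iff.2 ⟨hx.comp π.injective, hy.comp ρ.injective,
        fun a b => hxy _ _⟩
    · exact (measurable_card.comp measurable_fst (measurableSet_singleton i)).inter
        ((measurable_card.comp measurable_snd (measurableSet_singleton j)).inter
          (measurable_sortedAppend i j (measurableSet_injective _)))
  filter_upwards [h] with p hp
  rw [sortedUnion, tuple_append hp.2.2, (sortedTuple_spec hp.1).2, (sortedTuple_spec hp.2.1).2]

theorem slice_prod : (slice d i).prod (slice d j) =
    ((i.factorial : ℝ≥0∞)⁻¹ * (j.factorial : ℝ≥0∞)⁻¹) • (lebesgueN d i).prod (lebesgueN d j) := by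
  simp only [slice]
  rw [Measure.prod_smul_left, Measure.prod_smul_right, smul_smul]

theorem aemeasurable_union_slice : AEMeasurable (fun p : FinConf d × FinConf d => p.1 ∪ p.2)
    ((slice d i).prod (slice d j)) := by
  rw [slice_prod]
  exact AEMeasurable.smul_measure ⟨_, measurable_sortedUnion i j, ae_sortedUnion i j⟩ _

theorem map_union_lebesgueN : ((lebesgueN d i).prod (lebesgueN d j)).map
    (fun p : FinConf d × FinConf d => p.1 ∪ p.2) = lebesgueN d (i + j) := by
  rw [Measure.map_congr (ae_sortedUnion i j)]
  have h := ae_sortedUnion (d := d) i j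
  rw [lebesgueN_prod] at h ⊢
  rw [Measure.map_map (measurable_sortedUnion i j)
    ((measurable_tuple i).prodMap (measurable_tuple j)), lebesgueN_eq,
    ← (measurePreserving_append i j).map_eq,
    Measure.map_map (measurable_tuple _) (measurePreserving_append i j).measurable]
  refine Measure.map_congr ?_
  filter_upwards [ae_of_ae_map ((measurable_tuple i).prodMap (measurable_tuple j)).aemeasurable h,
    ae_injective_append i j] with p hp hp'
  simp only [Function.comp_apply]
  rw [← hp, tuple_append hp']
  rfl

/-- The union of independent slices: an `(i + j)`-point configuration splits into an `i`-point part
and its complement in `(i + j).choose i` ways. -/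
theorem map_union_slice : ((slice d i).prod (slice d j)).map
    (fun p : FinConf d × FinConf d => p.1 ∪ p.2) =
      ((i + j).choose i : ℝ≥0∞) • slice d (i + j) := by
  rw [slice_prod, Measure.map_smul, map_union_lebesgueN, slice, smul_smul]
  congr 1
  have h := Nat.add_choose_mul_factorial_mul_factorial i j
  have hi : (i.factorial : ℝ≥0∞) ≠ 0 := by exact_mod_cast i.factorial_ne_zero
  have hj : (j.factorial : ℝ≥0∞) ≠ 0 := by exact_mod_cast j.factorial_ne_zero
  have hij : ((i + j).factorial : ℝ≥0∞) ≠ 0 := by exact_mod_cast (i + j).factorial_ne_zero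
  rw [← ENNReal.mul_inv (.inl hi) (.inr hj), ← div_eq_mul_inv,
    ENNReal.eq_div_iff hij (ENNReal.natCast_ne_top _), ← h, Nat.choose_symm_add]
  push_cast
  rw [mul_assoc, mul_assoc, ← mul_assoc (i.factorial : ℝ≥0∞), ENNReal.mul_inv_cancel
    (mul_ne_zero hi hj) (ENNReal.mul_ne_top (ENNReal.natCast_ne_top _) (ENNReal.natCast_ne_top _)),
    mul_one]

theorem ae_card_union_slice : ∀ᵐ p ∂((slice d i).prod (slice d j)),
    p.1.card = i ∧ p.2.card = j ∧ (p.1 ∪ p.2).card = i + j := by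
  have h1 := Measure.ae_smul_measure (ae_slice_card (d := d) (i + j)) ((i + j).choose i : ℝ≥0∞)
  rw [← map_union_slice] at h1
  filter_upwards [ae_of_ae_map (aemeasurable_union_slice i j) h1,
    Measure.quasiMeasurePreserving_fst.ae (ae_slice_card i),
    Measure.quasiMeasurePreserving_snd.ae (ae_slice_card j)] with p hp h1 h2
  exact ⟨h1, h2, hp⟩

end Union

end FinConf

/-! ### The Lebesgue–Poisson integral of functions of a union -/

/-- The binomial transform `N ↦ ∑_{k + l = N} (N choose k) h(k, l)`, which counts, for a set of `N`
points, the splittings `(ξ, ζ)` of the set with weight `h(|ξ|, |ζ|)`. -/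
def binomSum {R : Type*} [Semiring R] (h : ℕ → ℕ → R) (N : ℕ) : R :=
  ∑ p ∈ Finset.HasAntidiagonal.antidiagonal N, (N.choose p.1 : R) * h p.1 p.2

namespace FinConf

variable {d : ℕ}

theorem slice_absolutelyContinuous (n : ℕ) : slice d n ≪ lebesguePoisson d :=
  Measure.absolutelyContinuous_sum_right n .rfl

theorem measurable_fun_card {β : Type*} [MeasurableSpace β] (f : ℕ → β) :
    Measurable fun η : FinConf d => f η.card :=
  (measurable_from_nat (f := f)).comp measurable_card

theorem measurable_fun_card_prod {β : Type*} [MeasurableSpace β] (f : ℕ → ℕ → β) :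
    Measurable fun p : FinConf d × FinConf d => f p.1.card p.2.card :=
  (measurable_from_prod_countable_left fun _ => measurable_from_nat :
    Measurable fun q : ℕ × ℕ => f q.1 q.2).comp
    ((measurable_card.comp measurable_fst).prodMk (measurable_card.comp measurable_snd))

variable [NeZero d]

theorem lebesguePoisson_prod : (lebesguePoisson d).prod (lebesguePoisson d) =
    Measure.sum fun p : ℕ × ℕ => (slice d p.1).prod (slice d p.2) := by
  rw [lebesguePoisson_eq_sum, Measure.prod_sum]

theorem aemeasurable_union : AEMeasurable (fun p : FinConf d × FinConf d => p.1 ∪ p.2)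
    ((lebesguePoisson d).prod (lebesguePoisson d)) := by
  rw [lebesguePoisson_prod]
  exact aemeasurable_sum_measure_iff.2 fun p => aemeasurable_union_slice p.1 p.2

theorem ae_card_union : ∀ᵐ p ∂((lebesguePoisson d).prod (lebesguePoisson d)),
    (p.1 ∪ p.2).card = p.1.card + p.2.card := by
  rw [lebesguePoisson_prod, Measure.ae_sum_iff]
  intro p
  filter_upwards [ae_card_union_slice p.1 p.2] with q hq
  rw [hq.1, hq.2.1, hq.2.2]

theorem map_union_slice_absolutelyContinuous (i j : ℕ) : ((slice d i).prod (slice d j)).map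
    (fun p : FinConf d × FinConf d => p.1 ∪ p.2) ≪ lebesguePoisson d := by
  rw [map_union_slice]
  exact (slice_absolutelyContinuous (i + j)).smul_left _

/-- The image of `λ ⊗ λ` under the union is absolutely continuous with respect to `λ`, so properties
that hold almost everywhere and classes of functions can be pulled back along the union. -/
theorem map_union_absolutelyContinuous :
    ((lebesguePoisson d).prod (lebesguePoisson d)).map
      (fun p : FinConf d × FinConf d => p.1 ∪ p.2) ≪ lebesguePoisson d := by
  have h := aemeasurable_union (d := d)
  rw [lebesguePoisson_prod] at h ⊢
  rw [Measure.map_sum h]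
  exact Measure.absolutelyContinuous_sum_left fun p =>
    map_union_slice_absolutelyContinuous p.1 p.2

theorem ae_union {P : FinConf d → Prop} (h : ∀ᵐ η ∂lebesguePoisson d, P η) :
    ∀ᵐ p ∂((lebesguePoisson d).prod (lebesguePoisson d)), P (p.1 ∪ p.2) :=
  ae_of_ae_map aemeasurable_union (map_union_absolutelyContinuous.ae_le h)

theorem aestronglyMeasurable_comp_union {β : Type*} [TopologicalSpace β] {F : FinConf d → β}
    (hF : AEStronglyMeasurable F (lebesguePoisson d)) :
    AEStronglyMeasurable (fun p : FinConf d × FinConf d => F (p.1 ∪ p.2))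
      ((lebesguePoisson d).prod (lebesguePoisson d)) :=
  (hF.mono_ac map_union_absolutelyContinuous).comp_aemeasurable aemeasurable_union

/-- The Lebesgue–Poisson measure turns a double integral over pairs of configurations into a single
integral over their union: for kernels depending on numbers of points only, the sum over the
splittings of the union becomes a binomial sum. -/
theorem lintegral_union (h : ℕ → ℕ → ℝ≥0∞) {F : FinConf d → ℝ≥0∞}
    (hF : AEMeasurable F (lebesguePoisson d)) :
    ∫⁻ p, h p.1.card p.2.card * F (p.1 ∪ p.2) ∂((lebesguePoisson d).prod (lebesguePoisson d)) =
      ∫⁻ ζ, binomSum h ζ.card * F ζ ∂(lebesguePoisson d) := by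
  have hl : ∀ p : ℕ × ℕ, ∫⁻ q, h q.1.card q.2.card * F (q.1 ∪ q.2)
      ∂((slice d p.1).prod (slice d p.2)) =
      ((p.1 + p.2).choose p.1 : ℝ≥0∞) * h p.1 p.2 * ∫⁻ ζ, F ζ ∂(slice d (p.1 + p.2)) := by
    intro p
    have hU := aemeasurable_union_slice (d := d) p.1 p.2
    have hFU := hF.mono_ac (map_union_slice_absolutelyContinuous p.1 p.2)
    have e : ∫⁻ q, h q.1.card q.2.card * F (q.1 ∪ q.2) ∂((slice d p.1).prod (slice d p.2)) =
        ∫⁻ q, h p.1 p.2 * F (q.1 ∪ q.2) ∂((slice d p.1).prod (slice d p.2)) :=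
      lintegral_congr_ae <| by
        filter_upwards [ae_card_union_slice p.1 p.2] with q hq
        rw [hq.1, hq.2.1]
    rw [e, lintegral_const_mul'' _ (f := fun q : FinConf d × FinConf d => F (q.1 ∪ q.2)) (hFU.comp_aemeasurable hU), ← lintegral_map' hFU hU,
      map_union_slice, lintegral_smul_measure]
    simp only [smul_eq_mul]
    ring
  have hr : ∀ n, ∫⁻ ζ, binomSum h ζ.card * F ζ ∂(slice d n) =
      binomSum h n * ∫⁻ ζ, F ζ ∂(slice d n) := by
    intro n
    rw [← lintegral_const_mul'' _ (hF.mono_ac (slice_absolutelyContinuous n))]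
    refine lintegral_congr_ae ?_
    filter_upwards [ae_slice_card n] with ζ hζ
    rw [hζ]
  rw [lebesguePoisson_prod, lintegral_sum_measure, lebesguePoisson_eq_sum, lintegral_sum_measure]
  simp_rw [hl, hr]
  rw [← Finset.HasAntidiagonal.sigmaAntidiagonalEquivProd.tsum_eq, ENNReal.tsum_sigma']
  refine tsum_congr fun n => ?_
  rw [tsum_fintype, binomSum, Finset.sum_mul, ← Finset.sum_coe_sort (Finset.HasAntidiagonal.antidiagonal n)]
  refine Fintype.sum_congr _ _ fun p => ?_
  have := Finset.HasAntidiagonal.mem_antidiagonal.1 p.2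
  simp only [Finset.HasAntidiagonal.sigmaAntidiagonalEquivProd_apply, this]

/-- The version of `lintegral_union` for integrable functions. -/
theorem integral_union {𝕜 : Type*} [RCLike 𝕜] (h : ℕ → ℕ → 𝕜) {F : FinConf d → 𝕜}
    (hF : AEStronglyMeasurable F (lebesguePoisson d))
    (hi : Integrable (fun p : FinConf d × FinConf d => h p.1.card p.2.card * F (p.1 ∪ p.2))
      ((lebesguePoisson d).prod (lebesguePoisson d))) :
    Integrable (fun ζ => binomSum h ζ.card * F ζ) (lebesguePoisson d) ∧
    ∫ p, h p.1.card p.2.card * F (p.1 ∪ p.2) ∂((lebesguePoisson d).prod (lebesguePoisson d)) =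
      ∫ ζ, binomSum h ζ.card * F ζ ∂(lebesguePoisson d) := by
  have hI : Integrable (fun ζ => binomSum h ζ.card * F ζ) (lebesguePoisson d) := by
    refine ⟨(measurable_fun_card _).aestronglyMeasurable.mul hF, ?_⟩
    have h1 := hi.2
    rw [hasFiniteIntegral_iff_enorm] at h1 ⊢
    simp_rw [enorm_mul] at h1
    rw [lintegral_union (fun k l => ‖h k l‖ₑ) hF.enorm] at h1
    refine (lintegral_mono fun ζ => ?_).trans_lt h1
    rw [enorm_mul]
    gcongr
    refine (enorm_sum_le _ _).trans (Finset.sum_le_sum fun p _ => ?_)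
    rw [enorm_mul]
    gcongr
    rw [← ofReal_norm, RCLike.norm_natCast, ENNReal.ofReal_natCast]
  refine ⟨hI, ?_⟩
  have hl : ∀ p : ℕ × ℕ, ∫ q, h q.1.card q.2.card * F (q.1 ∪ q.2)
      ∂((slice d p.1).prod (slice d p.2)) =
      ((p.1 + p.2).choose p.1 : 𝕜) * h p.1 p.2 * ∫ ζ, F ζ ∂(slice d (p.1 + p.2)) := by
    intro p
    have hU := aemeasurable_union_slice (d := d) p.1 p.2
    have hFU := hF.mono_ac (map_union_slice_absolutelyContinuous p.1 p.2)
    have e : ∫ q, h q.1.card q.2.card * F (q.1 ∪ q.2) ∂((slice d p.1).prod (slice d p.2)) =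
        ∫ q, h p.1 p.2 * F (q.1 ∪ q.2) ∂((slice d p.1).prod (slice d p.2)) :=
      integral_congr_ae <| by
        filter_upwards [ae_card_union_slice p.1 p.2] with q hq
        rw [hq.1, hq.2.1]
    rw [e, integral_const_mul, ← integral_map hU hFU, map_union_slice, integral_smul_measure,
      RCLike.real_smul_eq_coe_mul]
    simp only [ENNReal.toReal_natCast, RCLike.ofReal_natCast]
    ring
  have hr : ∀ n, ∫ ζ, binomSum h ζ.card * F ζ ∂(slice d n) =
      binomSum h n * ∫ ζ, F ζ ∂(slice d n) := by
    intro n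
    rw [← integral_const_mul]
    refine integral_congr_ae ?_
    filter_upwards [ae_slice_card n] with ζ hζ
    rw [hζ]
  rw [lebesguePoisson_prod] at hi ⊢
  rw [lebesguePoisson_eq_sum] at hI ⊢
  have s1 := hasSum_integral_measure hi
  have s2 := hasSum_integral_measure hI
  simp_rw [hl] at s1
  simp_rw [hr] at s2
  rw [← Finset.HasAntidiagonal.sigmaAntidiagonalEquivProd.hasSum_iff] at s1
  refine (s1.sigma fun n => ?_).unique s2
  convert hasSum_fintype _
  rw [binomSum, Finset.sum_mul, ← Finset.sum_coe_sort (Finset.HasAntidiagonal.antidiagonal n)]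
  refine Fintype.sum_congr _ _ fun p => ?_
  have := Finset.HasAntidiagonal.mem_antidiagonal.1 p.2
  simp only [Function.comp_apply, Finset.HasAntidiagonal.sigmaAntidiagonalEquivProd_apply, this]

end FinConf

/-! ### Integral operators whose kernel depends on the numbers of points -/

namespace FinConf

variable {d : ℕ}

section Density

variable {C : ℝ}

theorem ae_lebesguePoissonC (hC : 0 < C) :
    ae (lebesguePoissonC d C) = ae (lebesguePoisson d) := by
  refine le_antisymm (withDensity_absolutelyContinuous _ _).ae_le
    (withDensity_absolutelyContinuous' ?_ ?_).ae_le
  · exact (measurable_fun_card fun n => ENNReal.ofReal (C ^ n)).aemeasurable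
  · exact .of_forall fun η => by simp [pow_pos hC]

theorem aestronglyMeasurable_lebesguePoissonC {β : Type*} [TopologicalSpace β] {G : FinConf d → β}
    (hC : 0 < C) :
    AEStronglyMeasurable G (lebesguePoissonC d C) ↔ AEStronglyMeasurable G (lebesguePoisson d) :=
  ⟨fun h => h.mono_ac (Measure.ae_le_iff_absolutelyContinuous.1 (ae_lebesguePoissonC hC).ge),
    fun h => h.mono_ac (Measure.ae_le_iff_absolutelyContinuous.1 (ae_lebesguePoissonC hC).le)⟩

theorem eLpNorm_lebesguePoissonC {E : Type*} [NormedAddCommGroup E] (C : ℝ) (G : FinConf d → E) :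
    eLpNorm G 1 (lebesguePoissonC d C) =
      ∫⁻ η, ENNReal.ofReal (C ^ η.card) * ‖G η‖ₑ ∂(lebesguePoisson d) := by
  rw [eLpNorm_one_eq_lintegral_enorm, lebesguePoissonC,
    lintegral_withDensity_eq_lintegral_mul_non_measurable₀ _
      (measurable_fun_card fun n => ENNReal.ofReal (C ^ n)).aemeasurable
      (.of_forall fun η => ENNReal.ofReal_lt_top)]
  rfl

theorem aestronglyMeasurable_of_memLp {E : Type*} [NormedAddCommGroup E] (hC : 0 < C)
    {G : FinConf d → E} (hG : MemLp G 1 (lebesguePoissonC d C)) :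
    AEStronglyMeasurable G (lebesguePoisson d) :=
  (aestronglyMeasurable_lebesguePoissonC hC).1 hG.1

end Density

variable {𝕜 : Type*} [RCLike 𝕜]

/-- The integral operator on functions of configurations whose kernel depends on the numbers of
points only: `(K_a G)(η) = ∫ a(|η|, |ξ|) G(η ∪ ξ) dλ(ξ)`. -/
def kerOp (a : ℕ → ℕ → 𝕜) (G : FinConf d → 𝕜) (η : FinConf d) : 𝕜 :=
  ∫ ξ, a η.card ξ.card * G (η ∪ ξ) ∂(lebesguePoisson d)

/-- The norm of `K_a G` in `L_C` is at most the integral of `|G|` against this function of the number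
of points. -/
def kerWeight (a : ℕ → ℕ → 𝕜) (C : ℝ) : ℕ → ℝ := binomSum fun k l => ‖a k l‖ * C ^ k

/-- The kernel `a` defines a bounded operator from `L_{C'}` to `L_C`. -/
def KerBound (a : ℕ → ℕ → 𝕜) (C C' : ℝ) : Prop := ∃ M : ℝ, ∀ N, kerWeight a C N ≤ M * C' ^ N

/-- The kernel of the product of the operators with kernels `a` and `b`. -/
def kerComp (a b : ℕ → ℕ → 𝕜) (k : ℕ) : ℕ → 𝕜 := binomSum fun i j => a k i * b (k + i) j

theorem lintegral_kerWeight_le {a : ℕ → ℕ → 𝕜} {C C' : ℝ} {G : FinConf d → 𝕜} (hC' : 0 < C') {M : ℝ} 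
    (hM : ∀ N, kerWeight a C N ≤ M * C' ^ N) :
    ∫⁻ ζ, ENNReal.ofReal (kerWeight a C ζ.card) * ‖G ζ‖ₑ ∂(lebesguePoisson d) ≤
      ENNReal.ofReal M * eLpNorm G 1 (lebesguePoissonC d C') := by
  rw [eLpNorm_lebesguePoissonC, ← lintegral_const_mul' _ _ ENNReal.ofReal_ne_top]
  refine lintegral_mono fun ζ => ?_
  rw [← mul_assoc, ← ENNReal.ofReal_mul' (by positivity)]
  gcongr
  exact hM _

theorem lintegral_kerWeight_lt_top {a : ℕ → ℕ → 𝕜} {C C' : ℝ} {G : FinConf d → 𝕜} (hC' : 0 < C') 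
    (ha : KerBound a C C')
    (hG : MemLp G 1 (lebesguePoissonC d C')) :
    ∫⁻ ζ, ENNReal.ofReal (kerWeight a C ζ.card) * ‖G ζ‖ₑ ∂(lebesguePoisson d) < ∞ :=
  (lintegral_kerWeight_le hC' ha.choose_spec).trans_lt
    (ENNReal.mul_lt_top ENNReal.ofReal_lt_top hG.2)

variable [NeZero d] {a b : ℕ → ℕ → 𝕜} {C C' C'' : ℝ} {G G' : FinConf d → 𝕜}

theorem kerOp_congr (a : ℕ → ℕ → 𝕜) (h : G =ᵐ[lebesguePoisson d] G') :
    kerOp a G =ᵐ[lebesguePoisson d] kerOp a G' := by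
  filter_upwards [Measure.ae_ae_of_ae_prod (ae_union h)] with η hη
  refine integral_congr_ae ?_
  filter_upwards [hη] with ξ hξ
  rw [hξ]

theorem aestronglyMeasurable_ker (a : ℕ → ℕ → 𝕜)
    (hG : AEStronglyMeasurable G (lebesguePoisson d)) :
    AEStronglyMeasurable (fun p : FinConf d × FinConf d => a p.1.card p.2.card * G (p.1 ∪ p.2))
      ((lebesguePoisson d).prod (lebesguePoisson d)) :=
  (measurable_fun_card_prod a).aestronglyMeasurable.mul (aestronglyMeasurable_comp_union hG)

theorem aestronglyMeasurable_kerOp (a : ℕ → ℕ → 𝕜)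
    (hG : AEStronglyMeasurable G (lebesguePoisson d)) :
    AEStronglyMeasurable (kerOp a G) (lebesguePoisson d) :=
  (aestronglyMeasurable_ker a hG).integral_prod_right'

theorem lintegral_ker (a : ℕ → ℕ → 𝕜) (hC : 0 ≤ C)
    (hG : AEStronglyMeasurable G (lebesguePoisson d)) :
    ∫⁻ η, ∫⁻ ξ, ENNReal.ofReal (C ^ η.card) * ‖a η.card ξ.card * G (η ∪ ξ)‖ₑ
        ∂(lebesguePoisson d) ∂(lebesguePoisson d) =
      ∫⁻ ζ, ENNReal.ofReal (kerWeight a C ζ.card) * ‖G ζ‖ₑ ∂(lebesguePoisson d) := by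
  have hm : AEMeasurable (fun p : FinConf d × FinConf d =>
      ENNReal.ofReal (C ^ p.1.card) * ‖a p.1.card p.2.card * G (p.1 ∪ p.2)‖ₑ)
      ((lebesguePoisson d).prod (lebesguePoisson d)) :=
    (measurable_fun_card_prod fun k _ => ENNReal.ofReal (C ^ k)).aemeasurable.mul
      (aestronglyMeasurable_ker a hG).enorm
  have h := lintegral_union (fun k l => ENNReal.ofReal (‖a k l‖ * C ^ k)) hG.enorm
  rw [← lintegral_prod _ hm]
  calc _ = _ := lintegral_congr fun p => ?_
    _ = _ := h
    _ = _ := lintegral_congr fun ζ => ?_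
  · rw [enorm_mul, ENNReal.ofReal_mul (norm_nonneg _), ofReal_norm]; ring
  · congr 1
    rw [kerWeight, binomSum, binomSum, ENNReal.ofReal_sum_of_nonneg fun p _ => by positivity]
    refine Finset.sum_congr rfl fun p _ => ?_
    rw [ENNReal.ofReal_mul (p := ((_ : ℕ) : ℝ)) (by positivity), ENNReal.ofReal_natCast]

theorem eLpNorm_kerOp_le (a : ℕ → ℕ → 𝕜) (hC : 0 ≤ C)
    (hG : AEStronglyMeasurable G (lebesguePoisson d)) :
    eLpNorm (kerOp a G) 1 (lebesguePoissonC d C) ≤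
      ∫⁻ ζ, ENNReal.ofReal (kerWeight a C ζ.card) * ‖G ζ‖ₑ ∂(lebesguePoisson d) := by
  rw [eLpNorm_lebesguePoissonC, ← lintegral_ker a hC hG]
  refine lintegral_mono fun η => ?_
  rw [lintegral_const_mul' _ _ ENNReal.ofReal_ne_top]
  gcongr
  exact enorm_integral_le_lintegral_enorm _

theorem ae_integrable_ker (hC : 0 < C) (hC' : 0 < C') (ha : KerBound a C C')
    (hG : MemLp G 1 (lebesguePoissonC d C')) :
    ∀ᵐ η ∂(lebesguePoisson d),
      Integrable (fun ξ => a η.card ξ.card * G (η ∪ ξ)) (lebesguePoisson d) := by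
  have hGm := aestronglyMeasurable_of_memLp hC' hG
  have hm := aestronglyMeasurable_ker a hGm
  have hlt := lintegral_kerWeight_lt_top hC' ha hG
  rw [← lintegral_ker a hC.le hGm] at hlt
  have hm2 : AEMeasurable (fun p : FinConf d × FinConf d =>
      ENNReal.ofReal (C ^ p.1.card) * ‖a p.1.card p.2.card * G (p.1 ∪ p.2)‖ₑ)
      ((lebesguePoisson d).prod (lebesguePoisson d)) :=
    (measurable_fun_card_prod fun k _ => ENNReal.ofReal (C ^ k)).aemeasurable.mul hm.enorm
  filter_upwards [ae_lt_top' hm2.lintegral_prod_right' hlt.ne, hm.prodMk_left] with η h1 h2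
  refine ⟨h2, ?_⟩
  rw [hasFiniteIntegral_iff_enorm]
  rw [lintegral_const_mul' _ _ ENNReal.ofReal_ne_top] at h1
  exact ENNReal.lt_top_of_mul_ne_top_right h1.ne (by simpa using pow_pos hC _)

theorem memLp_kerOp (hC : 0 < C) (hC' : 0 < C') (ha : KerBound a C C')
    (hG : MemLp G 1 (lebesguePoissonC d C')) : MemLp (kerOp a G) 1 (lebesguePoissonC d C) :=
  have hGm := aestronglyMeasurable_of_memLp hC' hG
  ⟨(aestronglyMeasurable_lebesguePoissonC hC).2 (aestronglyMeasurable_kerOp a hGm),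
    (eLpNorm_kerOp_le a hC.le hGm).trans_lt (lintegral_kerWeight_lt_top hC' ha hG)⟩

/-- The operators `K_a` are closed under products. -/
theorem kerOp_kerOp (hC : 0 < C) (hC' : 0 < C') (hC'' : 0 < C'') (ha : KerBound a C C'')
    (hb : KerBound b C'' C') (hG : MemLp G 1 (lebesguePoissonC d C')) :
    kerOp a (kerOp b G) =ᵐ[lebesguePoisson d] kerOp (kerComp a b) G := by
  have hGm := aestronglyMeasurable_of_memLp hC' hG
  -- The function `H` dominates `kerOp b G`, and the operator with kernel `|a|` applies to it.
  let H : FinConf d → ℝ≥0∞ := fun η => ∫⁻ ζ, ‖b η.card ζ.card * G (η ∪ ζ)‖ₑ ∂(lebesguePoisson d)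
  have hHm : AEMeasurable H (lebesguePoisson d) :=
    (aestronglyMeasurable_ker b hGm).enorm.lintegral_prod_right'
  have hH : ∫⁻ η, ENNReal.ofReal (C'' ^ η.card) * H η ∂(lebesguePoisson d) < ∞ := by
    have h := lintegral_kerWeight_lt_top hC' hb hG
    rw [← lintegral_ker b hC''.le hGm] at h
    simpa only [lintegral_const_mul' _ _ ENNReal.ofReal_ne_top] using h
  have hfin : ∀ᵐ η ∂(lebesguePoisson d),
      ∫⁻ ξ, ‖a η.card ξ.card‖ₑ * H (η ∪ ξ) ∂(lebesguePoisson d) < ∞ := by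
    obtain ⟨M, hM⟩ := ha
    have h1 := lintegral_union (fun k l => ENNReal.ofReal (‖a k l‖ * C ^ k)) hHm
    have hm : AEMeasurable (fun p : FinConf d × FinConf d =>
        ENNReal.ofReal (‖a p.1.card p.2.card‖ * C ^ p.1.card) * H (p.1 ∪ p.2))
        ((lebesguePoisson d).prod (lebesguePoisson d)) :=
      (measurable_fun_card_prod fun k l => ENNReal.ofReal (‖a k l‖ * C ^ k)).aemeasurable.mul
        ((hHm.mono_ac map_union_absolutelyContinuous).comp_aemeasurable aemeasurable_union)
    have h2 : ∫⁻ ζ, binomSum (fun k l => ENNReal.ofReal (‖a k l‖ * C ^ k)) ζ.card * H ζ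
        ∂(lebesguePoisson d) < ∞ := by
      refine lt_of_le_of_lt ?_ (ENNReal.mul_lt_top (ENNReal.ofReal_lt_top (r := M)) hH)
      rw [← lintegral_const_mul' _ _ ENNReal.ofReal_ne_top]
      refine lintegral_mono fun ζ => ?_
      rw [← mul_assoc, ← ENNReal.ofReal_mul' (by positivity)]
      gcongr
      refine le_trans (le_of_eq ?_) (ENNReal.ofReal_le_ofReal (hM _))
      rw [kerWeight, binomSum, binomSum, ENNReal.ofReal_sum_of_nonneg fun p _ => by positivity]
      refine Finset.sum_congr rfl fun p _ => ?_
      rw [ENNReal.ofReal_mul (p := ((_ : ℕ) : ℝ)) (by positivity), ENNReal.ofReal_natCast]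
    rw [← h1, lintegral_prod _ hm] at h2
    filter_upwards [ae_lt_top' hm.lintegral_prod_right' h2.ne] with η hη
    have e : ∀ ξ : FinConf d, ENNReal.ofReal (‖a η.card ξ.card‖ * C ^ η.card) * H (η ∪ ξ) =
        ENNReal.ofReal (C ^ η.card) * (‖a η.card ξ.card‖ₑ * H (η ∪ ξ)) := fun ξ => by
      rw [ENNReal.ofReal_mul (norm_nonneg _), ofReal_norm]; ring
    simp_rw [e] at hη
    rw [lintegral_const_mul' _ _ ENNReal.ofReal_ne_top] at hη
    exact ENNReal.lt_top_of_mul_ne_top_right hη.ne (by simpa using pow_pos hC _)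
  filter_upwards [hfin, (aestronglyMeasurable_comp_union hGm).prodMk_left,
    Measure.ae_ae_of_ae_prod ae_card_union] with η h1 h2 h3
  -- For fixed `η`, `integral_union` applies to the function `ω ↦ G (η ∪ ω)`.
  have hassoc : ∀ ξ ζ : FinConf d, (η ∪ ξ) ∪ ζ = η ∪ (ξ ∪ ζ) := fun ξ ζ => by
    ext1; exact Finset.union_assoc _ _ _
  have hm := aestronglyMeasurable_ker (fun i j => a η.card i * b (η.card + i) j) h2
  have hi : Integrable (fun p : FinConf d × FinConf d =>
      (a η.card p.1.card * b (η.card + p.1.card) p.2.card) * G (η ∪ (p.1 ∪ p.2)))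
      ((lebesguePoisson d).prod (lebesguePoisson d)) := by
    refine ⟨hm, ?_⟩
    rw [hasFiniteIntegral_iff_enorm, lintegral_prod _ hm.enorm]
    refine lt_of_le_of_lt (le_of_eq (lintegral_congr_ae ?_)) h1
    filter_upwards [h3] with ξ hξ
    simp only [H]
    rw [← lintegral_const_mul' _ _ enorm_ne_top]
    simp_rw [← enorm_mul, hξ, hassoc, mul_assoc]
  have key := (integral_union (fun i j => a η.card i * b (η.card + i) j) h2 hi).2
  rw [integral_prod _ hi] at key
  calc kerOp a (kerOp b G) η = _ := integral_congr_ae ?_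
    _ = _ := key
  filter_upwards [h3] with ξ hξ
  simp only [kerOp]
  rw [← integral_const_mul]
  simp_rw [hξ, hassoc, mul_assoc]

theorem tendsto_eLpNorm_kerOp {ι : Type*} {l : Filter ι} [l.IsCountablyGenerated]
    {a : ι → ℕ → ℕ → 𝕜} (hC : 0 < C) (hC' : 0 < C') {M : ℝ}
    (hM : ∀ᶠ i in l, ∀ N, kerWeight (a i) C N ≤ M * C' ^ N)
    (hlim : ∀ k n, Tendsto (fun i => a i k n) l (𝓝 0)) (hG : MemLp G 1 (lebesguePoissonC d C')) :
    Tendsto (fun i => eLpNorm (kerOp (a i) G) 1 (lebesguePoissonC d C)) l (𝓝 0) := by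
  have hGm := aestronglyMeasurable_of_memLp hC' hG
  refine tendsto_of_tendsto_of_tendsto_of_le_of_le tendsto_const_nhds ?_ (fun i => zero_le)
    (fun i => eLpNorm_kerOp_le (a i) hC.le hGm)
  have hw : ∀ N, Tendsto (fun i => kerWeight (a i) C N) l (𝓝 0) := fun N => by
    have : Tendsto (fun i => kerWeight (a i) C N) l
        (𝓝 (∑ p ∈ Finset.HasAntidiagonal.antidiagonal N, (N.choose p.1 : ℝ) * (‖(0 : 𝕜)‖ * C ^ p.1))) :=
      tendsto_finsetSum _ fun p _ => ((hlim p.1 p.2).norm.mul_const _).const_mul _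
    simpa using this
  have := tendsto_lintegral_filter_of_dominated_convergence'
    (F := fun i (ζ : FinConf d) => ENNReal.ofReal (kerWeight (a i) C ζ.card) * ‖G ζ‖ₑ)
    (f := fun _ => 0) (l := l) (μ := lebesguePoisson d)
    (fun ζ => ENNReal.ofReal M * (ENNReal.ofReal (C' ^ ζ.card) * ‖G ζ‖ₑ))
    (.of_forall fun i => ?_) ?_ ?_ ?_
  · simpa using this
  · exact (measurable_fun_card fun N => ENNReal.ofReal (kerWeight (a i) C N)).aemeasurable.mul
      hGm.enorm
  · filter_upwards [hM] with i hi
    refine .of_forall fun ζ => ?_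
    rw [← mul_assoc, ← ENNReal.ofReal_mul' (by positivity)]
    gcongr
    exact hi _
  · rw [lintegral_const_mul' _ _ ENNReal.ofReal_ne_top, ← eLpNorm_lebesguePoissonC]
    exact ENNReal.mul_ne_top ENNReal.ofReal_ne_top hG.2.ne
  · refine .of_forall fun ζ => ?_
    have h := ENNReal.tendsto_ofReal (hw ζ.card)
    rw [ENNReal.ofReal_zero] at h
    simpa using ENNReal.Tendsto.mul_const h (.inr enorm_ne_top)

end FinConf

/-! ### Binomial sums -/

theorem binomSum_pow_mul_pow {R : Type*} [CommSemiring R] (x y : R) (N : ℕ) :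
    binomSum (fun k l => x ^ k * y ^ l) N = (x + y) ^ N := by
  rw [binomSum, (Commute.all x y).add_pow']
  simp [nsmul_eq_mul]

theorem binomSum_zero {R : Type*} [Semiring R] (h : ℕ → ℕ → R) : binomSum h 0 = h 0 0 := by
  simp [binomSum]

/-- For kernels supported by `l ≤ 1` only two splittings of a set contribute. -/
theorem binomSum_eq_of_right_le_one {R : Type*} [Semiring R] {h : ℕ → ℕ → R}
    (h2 : ∀ k l, 2 ≤ l → h k l = 0) (N : ℕ) :
    binomSum h (N + 1) = h (N + 1) 0 + (N + 1) * h N 1 := by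
  rw [binomSum, Finset.Nat.antidiagonal_succ', Finset.sum_cons, Finset.sum_map]
  cases N with
  | zero => simp
  | succ n =>
    rw [Finset.Nat.antidiagonal_succ', Finset.sum_cons, Finset.sum_map, Finset.sum_eq_zero]
    · simp
    · intro p _
      simp [h2]

theorem binomSum_swap {R : Type*} [Semiring R] (h : ℕ → ℕ → R) (N : ℕ) :
    binomSum (fun k l => h l k) N = binomSum h N := by
  rw [binomSum, ← Finset.Nat.sum_antidiagonal_swap, binomSum]
  refine Finset.sum_congr rfl fun p hp => ?_
  have := Finset.HasAntidiagonal.mem_antidiagonal.1 hp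
  simp only [Prod.fst_swap, Prod.snd_swap]
  rw [← this, Nat.choose_symm_add]

theorem binomSum_eq_of_left_le_one {R : Type*} [Semiring R] {h : ℕ → ℕ → R}
    (h2 : ∀ k l, 2 ≤ k → h k l = 0) (N : ℕ) :
    binomSum h (N + 1) = h 0 (N + 1) + (N + 1) * h 1 N := by
  rw [← binomSum_swap, binomSum_eq_of_right_le_one fun k l hl => h2 l k hl]

theorem binomSum_mono {h h' : ℕ → ℕ → ℝ} (hh : ∀ k l, h k l ≤ h' k l) (N : ℕ) :
    binomSum h N ≤ binomSum h' N :=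
  Finset.sum_le_sum fun p _ => by gcongr; exact hh _ _

theorem binomSum_add (h h' : ℕ → ℕ → ℝ) (N : ℕ) :
    binomSum (fun k l => h k l + h' k l) N = binomSum h N + binomSum h' N := by
  simp only [binomSum, mul_add, Finset.sum_add_distrib]

theorem binomSum_const_mul (c : ℝ) (h : ℕ → ℕ → ℝ) (N : ℕ) :
    binomSum (fun k l => c * h k l) N = c * binomSum h N := by
  simp only [binomSum, Finset.mul_sum]
  exact Finset.sum_congr rfl fun p _ => by ring

namespace FinConf

/-! ### Elementary kernels -/

section Kernels

variable {𝕜 : Type*} [RCLike 𝕜] {C C' : ℝ}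

theorem kerWeight_le_of_norm_le {a : ℕ → ℕ → 𝕜} {h : ℕ → ℕ → ℝ} (hC : 0 ≤ C)
    (ha : ∀ k l, ‖a k l‖ ≤ h k l) (N : ℕ) :
    kerWeight a C N ≤ binomSum (fun k l => h k l * C ^ k) N :=
  binomSum_mono (fun k l => by gcongr; exact ha k l) N

theorem kerWeight_sub_le (a b : ℕ → ℕ → 𝕜) (hC : 0 ≤ C) (N : ℕ) :
    kerWeight (a - b) C N ≤ kerWeight a C N + kerWeight b C N := by
  refine (kerWeight_le_of_norm_le hC (h := fun k l => ‖a k l‖ + ‖b k l‖)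
    (fun k l => norm_sub_le _ _) N).trans_eq ?_
  simp only [add_mul]
  exact binomSum_add _ _ N

theorem KerBound.sub {a b : ℕ → ℕ → 𝕜} (hC : 0 ≤ C) (ha : KerBound a C C')
    (hb : KerBound b C C') : KerBound (a - b) C C' := by
  obtain ⟨M, hM⟩ := ha
  obtain ⟨M', hM'⟩ := hb
  exact ⟨M + M', fun N => (kerWeight_sub_le a b hC N).trans <| by
    rw [add_mul]; exact add_le_add (hM N) (hM' N)⟩

theorem KerBound.smul {a : ℕ → ℕ → 𝕜} (c : 𝕜) (ha : KerBound a C C') :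
    KerBound (c • a) C C' := by
  obtain ⟨M, hM⟩ := ha
  refine ⟨‖c‖ * M, fun N => ?_⟩
  have : kerWeight (c • a) C N = ‖c‖ * kerWeight a C N := by
    rw [kerWeight, kerWeight, ← binomSum_const_mul]
    congr 1; funext k l
    simp [mul_assoc]
  rw [this, mul_assoc]
  gcongr
  exact hM N

/-- The kernel of the multiplication by a function `f(|η|)` of the number of points. -/
def diagKer (f : ℕ → 𝕜) (k l : ℕ) : 𝕜 := if l = 0 then f k else 0

/-- The kernel of `G ↦ ∫ G(· ∪ x) dx`. -/
def onePointKer (𝕜 : Type*) [RCLike 𝕜] (_k l : ℕ) : 𝕜 := if l = 1 then 1 else 0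

theorem kerWeight_diagKer (f : ℕ → 𝕜) (C : ℝ) (N : ℕ) :
    kerWeight (diagKer f) C N = ‖f N‖ * C ^ N := by
  rw [kerWeight]
  cases N with
  | zero => rw [binomSum_zero]; simp [diagKer]
  | succ n =>
    rw [binomSum_eq_of_right_le_one]
    · simp [diagKer]
    · intro k l hl
      simp [diagKer, show l ≠ 0 by omega]

end Kernels

section Slices

variable {d : ℕ}

theorem singleton_eq_tuple (x : EuclideanSpace ℝ (Fin d)) :
    ({x} : FinConf d) = tuple 1 fun _ => x := by
  rw [tuple_of_injective (Function.injective_of_subsingleton _)]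
  ext y
  change y ∈ ({x} : Finset _) ↔ _
  simp [ofTuple, eq_comm]

theorem measurable_singletonConf :
    Measurable fun x : EuclideanSpace ℝ (Fin d) => ({x} : FinConf d) := by
  simp_rw [singleton_eq_tuple]
  exact (measurable_tuple 1).comp (measurable_pi_lambda _ fun _ => measurable_id)

theorem onePoint_eq_indicator {𝕜 : Type*} [RCLike 𝕜] (G : FinConf d → 𝕜) (η : FinConf d) :
    (fun ξ : FinConf d => onePointKer 𝕜 η.card ξ.card * G (η ∪ ξ)) =
      Set.indicator {ξ | ξ.card = 1} fun ξ => G (η ∪ ξ) := by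
  funext ξ
  by_cases h : ξ.card = 1 <;> simp [onePointKer, h]

variable [NeZero d]

theorem restrict_card_eq (n : ℕ) :
    (lebesguePoisson d).restrict {ξ | ξ.card = n} = slice d n := by
  have hs : MeasurableSet {ξ : FinConf d | ξ.card = n} := measurable_card (measurableSet_singleton n)
  rw [lebesguePoisson_eq_sum, Measure.restrict_sum _ hs]
  ext s hs'
  rw [Measure.sum_apply _ hs', tsum_eq_single n]
  · rw [Measure.restrict_eq_self_of_ae_mem]
    exact ae_slice_card n
  · intro k hk
    rw [Measure.restrict_eq_zero.2, Measure.coe_zero, Pi.zero_apply]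
    refine measure_mono_null (fun ξ hξ => ?_) (ae_iff.1 (ae_slice_card (d := d) k))
    simp only [Set.mem_ofPred_eq] at hξ ⊢
    omega

theorem slice_zero : slice d 0 = Measure.dirac ⟨∅⟩ := by
  rw [slice, lebesgueN_eq, volume_pi, Measure.pi_of_empty _ (fun i => i.elim0),
    Measure.map_dirac' (measurable_tuple 0), tuple_of_injective (Function.injective_of_subsingleton _)]
  simp [ofTuple]

theorem slice_one : slice d 1 =
    volume.map fun x : EuclideanSpace ℝ (Fin d) => ({x} : FinConf d) := by
  have h := (volume_preserving_funUnique (Fin 1) (EuclideanSpace ℝ (Fin d))).symm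
  have hv : (volume : Measure (Fin 1 → EuclideanSpace ℝ (Fin d))) = _ := h.map_eq.symm
  rw [slice, lebesgueN_eq, hv, Measure.map_map (measurable_tuple 1) h.measurable]
  simp only [Nat.factorial_one, Nat.cast_one, inv_one, one_smul]
  exact congrArg (fun f => volume.map f) (funext fun x => (singleton_eq_tuple x).symm)

variable {𝕜 : Type*} [RCLike 𝕜] {C C' : ℝ} {G : FinConf d → 𝕜}

theorem kerOp_diagKer (f : ℕ → 𝕜) (G : FinConf d → 𝕜) (η : FinConf d) :
    kerOp (diagKer f) G η = f η.card * G η := by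
  have e : (fun ξ : FinConf d => diagKer f η.card ξ.card * G (η ∪ ξ)) =
      Set.indicator {ξ | ξ.card = 0} fun _ => f η.card * G η := by
    funext ξ
    by_cases h : ξ.card = 0
    · have h' : η ∪ ξ = η := by
        ext1
        exact (Finset.union_eq_left).2 (by simp [Finset.card_eq_zero.1 h])
      simp [diagKer, h, h']
    · simp [diagKer, h]
  have hs : MeasurableSet {ξ : FinConf d | ξ.card = 0} := measurable_card (measurableSet_singleton 0)
  rw [kerOp, e, integral_indicator hs, restrict_card_eq, slice_zero]
  simp

theorem integrable_union_singleton {η : FinConf d}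
    (h : Integrable (fun ξ => onePointKer 𝕜 η.card ξ.card * G (η ∪ ξ)) (lebesguePoisson d)) :
    Integrable (fun x : EuclideanSpace ℝ (Fin d) => G (η ∪ {x})) ∧
      kerOp (onePointKer 𝕜) G η = ∫ x : EuclideanSpace ℝ (Fin d), G (η ∪ {x}) := by
  have hs : MeasurableSet {ξ : FinConf d | ξ.card = 1} := measurable_card (measurableSet_singleton 1)
  rw [kerOp]
  rw [onePoint_eq_indicator] at h ⊢
  rw [integrable_indicator_iff hs, IntegrableOn, restrict_card_eq, slice_one] at h
  rw [integral_indicator hs, restrict_card_eq, slice_one]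
  have hm := measurable_singletonConf (d := d)
  exact ⟨(integrable_map_measure h.1 hm.aemeasurable).1 h, integral_map hm.aemeasurable h.1⟩

end Slices

end FinConf

/-! ### Kernel operators on the spaces `L_C` -/

namespace FinConf

variable {d : ℕ} {𝕜 : Type*} [RCLike 𝕜] {a b : ℕ → ℕ → 𝕜} {C C' : ℝ}
  {G G' : FinConf d → 𝕜}

theorem kerOp_smul (a : ℕ → ℕ → 𝕜) (c : 𝕜) (G : FinConf d → 𝕜) :
    kerOp a (c • G) = c • kerOp a G := by
  funext η
  simp only [kerOp, Pi.smul_apply, smul_eq_mul, ← integral_const_mul, mul_left_comm]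

/-- A factor depending on `|η|` only comes out of the integral; no integrability is needed. -/
theorem kerOp_mul_left (f : ℕ → 𝕜) (a : ℕ → ℕ → 𝕜) (G : FinConf d → 𝕜) (η : FinConf d) :
    kerOp (fun k l => f k * a k l) G η = f η.card * kerOp a G η := by
  simp only [kerOp, ← integral_const_mul, mul_assoc]

theorem kerOp_smul_ker (c : 𝕜) (a : ℕ → ℕ → 𝕜) (G : FinConf d → 𝕜) :
    kerOp (c • a) G = c • kerOp a G :=
  funext fun η => kerOp_mul_left (fun _ => c) a G η

theorem ae_iff_lebesguePoissonC (hC : 0 < C) {p : FinConf d → Prop} :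
    (∀ᵐ η ∂(lebesguePoissonC d C), p η) ↔ ∀ᵐ η ∂(lebesguePoisson d), p η := by
  rw [ae_lebesguePoissonC hC]

theorem aeEq_iff_lebesguePoissonC (hC : 0 < C) {β : Type*} {f g : FinConf d → β} :
    f =ᵐ[lebesguePoissonC d C] g ↔ f =ᵐ[lebesguePoisson d] g :=
  ae_iff_lebesguePoissonC hC

theorem spaceLC_ext (hC : 0 < C) {x y : SpaceLC 𝕜 d C} (h : x =ᵐ[lebesguePoisson d] y) : x = y :=
  Lp.ext ((aeEq_iff_lebesguePoissonC hC).2 h)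

theorem coeFn_toLp' (hC : 0 < C) (hG : MemLp G 1 (lebesguePoissonC d C)) :
    hG.toLp G =ᵐ[lebesguePoisson d] G :=
  (aeEq_iff_lebesguePoissonC hC).1 hG.coeFn_toLp

theorem coeFn_sub' (hC : 0 < C) (x y : SpaceLC 𝕜 d C) :
    ((x - y : SpaceLC 𝕜 d C) : FinConf d → 𝕜) =ᵐ[lebesguePoisson d] ⇑x - ⇑y :=
  (aeEq_iff_lebesguePoissonC hC).1 (Lp.coeFn_sub x y)

theorem coeFn_smul' (hC : 0 < C) (c : 𝕜) (x : SpaceLC 𝕜 d C) :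
    ((c • x : SpaceLC 𝕜 d C) : FinConf d → 𝕜) =ᵐ[lebesguePoisson d] c • ⇑x :=
  (aeEq_iff_lebesguePoissonC hC).1 (Lp.coeFn_smul c x)

theorem kerBound_diagKer_one : KerBound (diagKer (1 : ℕ → 𝕜)) C C :=
  ⟨1, fun N => by simp [kerWeight_diagKer]⟩

variable [NeZero d]

theorem kerOp_add (hC : 0 < C) (hC' : 0 < C') (ha : KerBound a C C')
    (hG : MemLp G 1 (lebesguePoissonC d C')) (hG' : MemLp G' 1 (lebesguePoissonC d C')) :
    kerOp a (G + G') =ᵐ[lebesguePoisson d] kerOp a G + kerOp a G' := by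
  filter_upwards [ae_integrable_ker hC hC' ha hG, ae_integrable_ker hC hC' ha hG'] with η h h'
  simp only [kerOp, Pi.add_apply, mul_add]
  exact integral_add h h'

theorem kerOp_sub_ker (hC : 0 < C) (hC' : 0 < C') (ha : KerBound a C C') (hb : KerBound b C C')
    (hG : MemLp G 1 (lebesguePoissonC d C')) :
    kerOp (a - b) G =ᵐ[lebesguePoisson d] kerOp a G - kerOp b G := by
  filter_upwards [ae_integrable_ker hC hC' ha hG, ae_integrable_ker hC hC' hb hG] with η h h'
  simp only [kerOp, Pi.sub_apply, sub_mul]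
  exact integral_sub h h'

theorem kerOp_add_ker (hC : 0 < C) (hC' : 0 < C') (ha : KerBound a C C') (hb : KerBound b C C')
    (hG : MemLp G 1 (lebesguePoissonC d C')) :
    kerOp (a + b) G =ᵐ[lebesguePoisson d] kerOp a G + kerOp b G := by
  filter_upwards [ae_integrable_ker hC hC' ha hG, ae_integrable_ker hC hC' hb hG] with η h h'
  simp only [kerOp, Pi.add_apply, add_mul]
  exact integral_add h h'

/-- The bounded operator on `L_C` with kernel `a`. -/
def kerCLM (d : ℕ) [NeZero d] (hC : 0 < C) (ha : KerBound a C C) :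
    SpaceLC 𝕜 d C →L[𝕜] SpaceLC 𝕜 d C :=
  LinearMap.mkContinuous
    { toFun := fun x => (memLp_kerOp hC hC ha (Lp.memLp x)).toLp _
      map_add' := fun x y => by
        rw [← MemLp.toLp_add, MemLp.toLp_eq_toLp_iff, aeEq_iff_lebesguePoissonC hC]
        exact (kerOp_congr a ((aeEq_iff_lebesguePoissonC hC).1 (Lp.coeFn_add x y))).trans
          (kerOp_add hC hC ha (Lp.memLp x) (Lp.memLp y))
      map_smul' := fun c x => by
        rw [RingHom.id_apply, ← MemLp.toLp_const_smul, MemLp.toLp_eq_toLp_iff,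
          aeEq_iff_lebesguePoissonC hC, ← kerOp_smul]
        exact kerOp_congr a (coeFn_smul' hC c x) }
    (max ha.choose 0) fun x => by
      rw [LinearMap.coe_mk, AddHom.coe_mk, Lp.norm_toLp, Lp.norm_def,
        ← ENNReal.toReal_ofReal (le_max_right ha.choose 0), ← ENNReal.toReal_mul]
      refine ENNReal.toReal_mono (ENNReal.mul_ne_top ENNReal.ofReal_ne_top (Lp.memLp x).2.ne) ?_
      refine (eLpNorm_kerOp_le a hC.le (aestronglyMeasurable_of_memLp hC (Lp.memLp x))).trans
        (lintegral_kerWeight_le hC fun N => (ha.choose_spec N).trans ?_)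
      gcongr
      exact le_max_left _ _

theorem kerCLM_coe (hC : 0 < C) (ha : KerBound a C C) (x : SpaceLC 𝕜 d C) :
    kerCLM d hC ha x =ᵐ[lebesguePoisson d] kerOp a x :=
  coeFn_toLp' hC (memLp_kerOp hC hC ha (Lp.memLp x))

theorem kerCLM_toLp (hC : 0 < C) (ha : KerBound a C C) (hG : MemLp G 1 (lebesguePoissonC d C)) :
    kerCLM d hC ha (hG.toLp G) =ᵐ[lebesguePoisson d] kerOp a G :=
  (kerCLM_coe hC ha _).trans (kerOp_congr a (coeFn_toLp' hC hG))

theorem norm_kerCLM_le (hC : 0 < C) (ha : KerBound a C C) {M : ℝ} (hM0 : 0 ≤ M)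
    (hM : ∀ N, kerWeight a C N ≤ M * C ^ N) : ‖kerCLM d hC ha‖ ≤ M := by
  refine ContinuousLinearMap.opNorm_le_bound _ hM0 fun x => ?_
  have e : eLpNorm (kerCLM d hC ha x) 1 (lebesguePoissonC d C) =
      eLpNorm (kerOp a x) 1 (lebesguePoissonC d C) :=
    eLpNorm_congr_ae ((aeEq_iff_lebesguePoissonC hC).2 (kerCLM_coe hC ha x))
  rw [Lp.norm_def, Lp.norm_def, e, ← ENNReal.toReal_ofReal hM0, ← ENNReal.toReal_mul]
  refine ENNReal.toReal_mono (ENNReal.mul_ne_top ENNReal.ofReal_ne_top (Lp.memLp x).2.ne) ?_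
  exact (eLpNorm_kerOp_le a hC.le (aestronglyMeasurable_of_memLp hC (Lp.memLp x))).trans
    (lintegral_kerWeight_le hC hM)

/-- Dominated convergence for kernel operators. -/
theorem tendsto_zero_of_coe_eq_kerOp {ι : Type*} {l : Filter ι} [l.IsCountablyGenerated]
    {a : ι → ℕ → ℕ → 𝕜} (hC : 0 < C) (hC' : 0 < C') {M : ℝ}
    (hM : ∀ᶠ i in l, ∀ N, kerWeight (a i) C N ≤ M * C' ^ N)
    (hlim : ∀ k n, Tendsto (fun i => a i k n) l (𝓝 0)) (hG : MemLp G 1 (lebesguePoissonC d C'))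
    {y : ι → SpaceLC 𝕜 d C} (hy : ∀ᶠ i in l, y i =ᵐ[lebesguePoisson d] kerOp (a i) G) :
    Tendsto y l (𝓝 0) := by
  rw [tendsto_zero_iff_norm_tendsto_zero]
  have h := (ENNReal.tendsto_toReal ENNReal.zero_ne_top).comp
    (tendsto_eLpNorm_kerOp hC hC' hM hlim hG)
  rw [ENNReal.toReal_zero] at h
  refine h.congr' ?_
  filter_upwards [hy] with i hi
  rw [Lp.norm_def, eLpNorm_congr_ae ((aeEq_iff_lebesguePoissonC hC).2 hi)]
  rfl

theorem kerOp_diagKer_one (G : FinConf d → 𝕜) : kerOp (diagKer 1) G = G := by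
  funext η; simp [kerOp_diagKer]

/-- Cutting off large configurations approximates the functions of `L_C` by functions of the smaller
spaces `L_{C'}`. -/
theorem exists_tendsto_memLp (hC : 0 < C) (hCC : C ≤ C') (x : SpaceLC 𝕜 d C) :
    ∃ y : ℕ → SpaceLC 𝕜 d C, (∀ n, MemLp (y n) 1 (lebesguePoissonC d C')) ∧
      Tendsto y atTop (𝓝 x) := by
  have hC' := hC.trans_le hCC
  let f : ℕ → ℕ → 𝕜 := fun n k => if k ≤ n then 1 else 0
  have hf : ∀ n k, ‖f n k‖ ≤ 1 := fun n k => by simp only [f]; split_ifs <;> simp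
  have hb : ∀ n N, kerWeight (diagKer (f n)) C N ≤ 1 * C ^ N := fun n N => by
    rw [kerWeight_diagKer]
    gcongr
    exact hf n N
  have hb' : ∀ n, KerBound (diagKer (f n)) C' C := fun n => ⟨(C' / C) ^ n, fun N => by
    rw [kerWeight_diagKer]
    -- Up to `n` points, the weight `C' ^ N` is at most `(C' / C) ^ n * C ^ N`.
    by_cases hN : N ≤ n
    · simp only [f, hN, if_true, norm_one, one_mul]
      calc C' ^ N = (C' / C) ^ N * C ^ N := by rw [← mul_pow, div_mul_cancel₀ _ hC.ne']
        _ ≤ (C' / C) ^ n * C ^ N := by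
          gcongr
          exact (one_le_div hC).2 hCC
    · simp only [f, hN, if_false, norm_zero, zero_mul]
      positivity⟩
  refine ⟨fun n => kerCLM d hC ⟨1, hb n⟩ x, fun n => ?_, ?_⟩
  · refine (memLp_kerOp hC' hC (hb' n) (Lp.memLp x)).ae_eq ?_
    exact (aeEq_iff_lebesguePoissonC hC').2 (kerCLM_coe hC _ x).symm
  · rw [← tendsto_sub_nhds_zero_iff]
    refine tendsto_zero_of_coe_eq_kerOp (a := fun n => diagKer (f n) - diagKer 1) hC hC (M := 2)
      (.of_forall fun n N => ?_) (fun k l => ?_) (Lp.memLp x) (.of_forall fun n => ?_)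
    · refine (kerWeight_sub_le _ _ hC.le N).trans ?_
      have h1 := hb n N
      have h2 : kerWeight (diagKer (1 : ℕ → 𝕜)) C N = C ^ N := by simp [kerWeight_diagKer]
      linarith
    · refine tendsto_const_nhds.congr' ?_
      filter_upwards [eventually_ge_atTop k] with n hn
      simp [diagKer, f, hn]
    · refine (coeFn_sub' hC _ _).trans (.trans ?_ (kerOp_sub_ker hC hC ⟨1, hb n⟩
        kerBound_diagKer_one (Lp.memLp x)).symm)
      rw [kerOp_diagKer_one]
      exact (kerCLM_coe hC _ x).sub .rfl

end FinConf

namespace FinConf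

section ConcreteKernels

variable (𝕜 : Type*) [RCLike 𝕜] (m σ C : ℝ)

/-- The kernel of `L̂`. -/
def genKer : ℕ → ℕ → 𝕜 :=
  diagKer (fun k => ((-(m * k) : ℝ) : 𝕜)) + (σ : 𝕜) • onePointKer 𝕜

/-- The kernel of `T̂(t)`. -/
def semiKer (t : ℝ) (k l : ℕ) : 𝕜 :=
  ((Real.exp (-(t * m * k)) * (σ / m * (1 - Real.exp (-(t * m)))) ^ l : ℝ) : 𝕜)

variable {𝕜}

/-- The kernel of the resolvent at `z`, with the beta function written out as
`B(z / m + k, l + 1) / m = l! mˡ / ∏_{j ≤ l} (z + m (k + j))`. -/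
def resKer (z : 𝕜) (k l : ℕ) : 𝕜 :=
  (σ : 𝕜) ^ l * (l.factorial : 𝕜) / ∏ j ∈ Finset.range (l + 1), (z + m * (k + j))

variable {m σ C}

/-! ### The kernel of the generator -/

theorem genKer_zero (k : ℕ) : genKer 𝕜 m σ k 0 = ((-(m * k) : ℝ) : 𝕜) := by
  simp [genKer, diagKer, onePointKer]

theorem genKer_one (k : ℕ) : genKer 𝕜 m σ k 1 = (σ : 𝕜) := by
  simp [genKer, diagKer, onePointKer, RCLike.real_smul_eq_coe_mul]

theorem genKer_of_two_le (k : ℕ) {l : ℕ} (hl : 2 ≤ l) : genKer 𝕜 m σ k l = 0 := by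
  simp [genKer, diagKer, onePointKer, show l ≠ 0 by omega, show l ≠ 1 by omega]

theorem cast_le_two_pow (N : ℕ) : (N : ℝ) ≤ 2 ^ N := by
  exact_mod_cast Nat.lt_two_pow_self.le

theorem kerBound_onePointKer (hC : 0 < C) : KerBound (onePointKer 𝕜) C (2 * C) := by
  refine ⟨1 / C, fun N => ?_⟩
  cases N with
  | zero => rw [kerWeight, binomSum_zero]; simp [onePointKer, hC.le]
  | succ n =>
    rw [kerWeight, binomSum_eq_of_right_le_one]
    · have h := cast_le_two_pow (n + 1)
      push_cast at h
      have : 1 / C * (2 * C) ^ (n + 1) = 2 ^ (n + 1) * C ^ n := by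
        field_simp; ring
      rw [this]
      simp only [onePointKer, zero_ne_one, if_false, norm_zero, zero_mul, zero_add, if_true,
        norm_one, one_mul]
      gcongr
    · intro k l hl
      simp [onePointKer, show l ≠ 1 by omega]

theorem kerBound_diagKer_linear (hm : 0 ≤ m) (hC : 0 < C) :
    KerBound (diagKer fun k => ((-(m * k) : ℝ) : 𝕜)) C (2 * C) := by
  refine ⟨m, fun N => ?_⟩
  rw [kerWeight_diagKer, RCLike.norm_ofReal, abs_neg, abs_of_nonneg (by positivity), mul_pow,
    ← mul_assoc]
  gcongr
  exact cast_le_two_pow N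

/-- The weight of the kernel of `L̂` grows like `N C ^ N`; the factor `N` is absorbed by `2 ^ N`. -/
theorem kerBound_genKer (hm : 0 ≤ m) (hC : 0 < C) : KerBound (genKer 𝕜 m σ) C (2 * C) := by
  obtain ⟨M, hM⟩ := (kerBound_diagKer_linear (𝕜 := 𝕜) hm hC).sub hC.le
    ((kerBound_onePointKer (𝕜 := 𝕜) hC).smul (-(σ : 𝕜)))
  refine ⟨M, fun N => le_of_eq_of_le ?_ (hM N)⟩
  rw [genKer, neg_smul, sub_neg_eq_add]

variable (𝕜 m σ) in
/-- The kernel of `2^{-|η|} L̂`, which is bounded on `L_C`. -/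
def dampedGenKer (k l : ℕ) : 𝕜 := (2⁻¹ : 𝕜) ^ k * genKer 𝕜 m σ k l

/-- The factor `2 ^ (-k)` compensates the growth of `L̂` in the number of points. -/
theorem kerBound_dampedGenKer (hm : 0 ≤ m) (hC : 0 < C) : KerBound (dampedGenKer 𝕜 m σ) C C := by
  have h2 : ‖(2⁻¹ : 𝕜)‖ = 2⁻¹ := by simp
  refine ⟨m + 2 * |σ| / C, fun N => ?_⟩
  cases N with
  | zero =>
    rw [kerWeight, binomSum_zero]
    simp only [dampedGenKer, genKer_zero]
    simp
    positivity
  | succ n =>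
    rw [kerWeight, binomSum_eq_of_right_le_one]
    · have h := cast_le_two_pow (n + 1)
      push_cast at h
      have h' : ((n : ℝ) + 1) * 2⁻¹ ^ (n + 1) ≤ 1 := by
        rw [inv_pow, ← div_eq_mul_inv]
        exact (div_le_one (by positivity)).2 h
      simp only [dampedGenKer, genKer_zero, genKer_one, norm_mul, norm_pow, h2, RCLike.norm_ofReal,
        abs_neg, abs_mul, abs_of_nonneg hm]
      push_cast
      rw [abs_of_nonneg (by positivity : (0 : ℝ) ≤ (n : ℝ) + 1)]
      calc _ = (((n : ℝ) + 1) * 2⁻¹ ^ (n + 1)) * ((m + 2 * |σ| / C) * C ^ (n + 1)) := by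
            field_simp; ring
        _ ≤ 1 * ((m + 2 * |σ| / C) * C ^ (n + 1)) := by gcongr
        _ = _ := one_mul _
    · intro k l hl
      simp [dampedGenKer, genKer_of_two_le k hl]

theorem kerBound_diagKer_inv_two_pow (hC : 0 ≤ C) :
    KerBound (diagKer fun k => (2⁻¹ : 𝕜) ^ k) C C := by
  refine ⟨1, fun N => ?_⟩
  have : ‖(2⁻¹ : 𝕜)‖ = 2⁻¹ := by simp
  rw [kerWeight_diagKer, norm_pow, this]
  exact mul_le_mul_of_nonneg_right (pow_le_one₀ (by norm_num) (by norm_num)) (pow_nonneg hC N)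

/-! ### The kernel of the semigroup -/

theorem one_sub_exp_nonneg {s : ℝ} (hs : 0 ≤ s) : 0 ≤ 1 - Real.exp (-s) := by
  rw [sub_nonneg, Real.exp_le_one_iff]; linarith

theorem kerWeight_semiKer (hm : 0 < m) (hσ : 0 ≤ σ) {t : ℝ} (ht : 0 ≤ t) (C : ℝ) (N : ℕ) :
    kerWeight (semiKer 𝕜 m σ t) C N =
      (Real.exp (-(t * m)) * C + σ / m * (1 - Real.exp (-(t * m)))) ^ N := by
  have h1 := one_sub_exp_nonneg (s := t * m) (by positivity)
  rw [kerWeight, ← binomSum_pow_mul_pow]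
  congr 1
  funext k l
  rw [semiKer, RCLike.norm_ofReal, abs_of_nonneg (by positivity), mul_pow (Real.exp _) C,
    ← Real.exp_nat_mul]
  rw [show (k : ℝ) * -(t * m) = -(t * m * k) by ring]
  ring

/-- The contraction property: `e^{-tm} C + (1 - e^{-tm}) σ / m` is a convex combination of `C` and
`σ / m ≤ C`. -/
theorem kerWeight_semiKer_le (hm : 0 < m) (hσ : 0 ≤ σ) {t : ℝ} (ht : 0 ≤ t) (hC : 0 ≤ C)
    (hCσ : σ / m ≤ C) (N : ℕ) : kerWeight (semiKer 𝕜 m σ t) C N ≤ 1 * C ^ N := by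
  have h1 := one_sub_exp_nonneg (s := t * m) (by positivity)
  rw [kerWeight_semiKer hm hσ ht, one_mul]
  refine pow_le_pow_left₀ (by positivity) ?_ N
  nlinarith [mul_le_mul_of_nonneg_right hCσ h1]

theorem semiKer_zero : semiKer 𝕜 m σ 0 = diagKer 1 := by
  funext k l
  by_cases hl : l = 0 <;> simp [semiKer, diagKer, hl]

/-- The semigroup law, by the binomial theorem. -/
theorem kerComp_semiKer (s t : ℝ) :
    kerComp (semiKer 𝕜 m σ s) (semiKer 𝕜 m σ t) = semiKer 𝕜 m σ (s + t) := by
  funext k l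
  have e : ∀ i j : ℕ, semiKer 𝕜 m σ s k i * semiKer 𝕜 m σ t (k + i) j =
      ((Real.exp (-((s + t) * m * k)) : ℝ) : 𝕜) *
        ((((σ / m * (1 - Real.exp (-(s * m)))) * Real.exp (-(t * m)) : ℝ) : 𝕜) ^ i *
          ((σ / m * (1 - Real.exp (-(t * m))) : ℝ) : 𝕜) ^ j) := by
    intro i j
    simp only [semiKer, ← RCLike.ofReal_pow, ← RCLike.ofReal_mul]
    congr 1
    rw [mul_pow (σ / m * (1 - Real.exp (-(s * m)))), ← Real.exp_nat_mul (-(t * m)) i]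
    have : Real.exp (-((s + t) * m * k)) * Real.exp (i * -(t * m)) =
        Real.exp (-(s * m * k)) * Real.exp (-(t * m * ((k + i : ℕ) : ℝ))) := by
      rw [← Real.exp_add, ← Real.exp_add]; congr 1; push_cast; ring
    linear_combination -(σ / m * (1 - Real.exp (-(s * m)))) ^ i *
      (σ / m * (1 - Real.exp (-(t * m)))) ^ j * this
  rw [kerComp]
  simp_rw [e]
  have h := binomSum_pow_mul_pow
    (((σ / m * (1 - Real.exp (-(s * m)))) * Real.exp (-(t * m)) : ℝ) : 𝕜)
    ((σ / m * (1 - Real.exp (-(t * m))) : ℝ) : 𝕜) l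
  have h' : binomSum (fun i j => ((Real.exp (-((s + t) * m * k)) : ℝ) : 𝕜) *
        ((((σ / m * (1 - Real.exp (-(s * m)))) * Real.exp (-(t * m)) : ℝ) : 𝕜) ^ i *
          ((σ / m * (1 - Real.exp (-(t * m))) : ℝ) : 𝕜) ^ j)) l =
      ((Real.exp (-((s + t) * m * k)) : ℝ) : 𝕜) * binomSum (fun i j =>
        ((((σ / m * (1 - Real.exp (-(s * m)))) * Real.exp (-(t * m)) : ℝ) : 𝕜) ^ i *
          ((σ / m * (1 - Real.exp (-(t * m))) : ℝ) : 𝕜) ^ j)) l := by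
    simp only [binomSum, Finset.mul_sum]
    exact Finset.sum_congr rfl fun p _ => by ring
  rw [h', h, semiKer]
  simp only [← RCLike.ofReal_pow, ← RCLike.ofReal_mul, ← RCLike.ofReal_add]
  congr 3
  have : Real.exp (-((s + t) * m)) = Real.exp (-(s * m)) * Real.exp (-(t * m)) := by
    rw [← Real.exp_add]; congr 1; ring
  rw [this]; ring

theorem continuous_semiKer (k l : ℕ) : Continuous fun t : ℝ≥0 => semiKer 𝕜 m σ t k l := by
  unfold semiKer
  refine RCLike.continuous_ofReal.comp ?_
  fun_prop

/-- The derivative at `0` of the kernel of `T̂(t)` is the kernel of `L̂`. -/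
theorem hasDerivAt_semiKer (hm : m ≠ 0) (k l : ℕ) :
    HasDerivAt (fun t : ℝ => Real.exp (-(t * m * k)) * (σ / m * (1 - Real.exp (-(t * m)))) ^ l)
      (if l = 0 then -(m * k) else if l = 1 then σ else 0) 0 := by
  have h1 : HasDerivAt (fun t : ℝ => Real.exp (-(t * m * k))) (-(m * k)) 0 := by
    have := ((((hasDerivAt_id (0 : ℝ)).mul_const m).mul_const (k : ℝ)).neg).exp
    simpa using this
  have h2 : HasDerivAt (fun t : ℝ => σ / m * (1 - Real.exp (-(t * m)))) σ 0 := by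
    have := ((((hasDerivAt_id (0 : ℝ)).mul_const m).neg.exp).const_sub 1).const_mul (σ / m)
    refine HasDerivAt.congr_deriv this ?_
    field_simp
    simp
  have h3 := h1.mul (h2.pow l)
  refine HasDerivAt.congr_deriv h3 ?_
  rcases l with _ | _ | l <;> simp

theorem tendsto_slope_semiKer (hm : m ≠ 0) (k l : ℕ) :
    Tendsto (fun t : ℝ≥0 => (((((t : ℝ) : 𝕜)⁻¹) • (semiKer 𝕜 m σ t - diagKer 1) -
      genKer 𝕜 m σ : ℕ → ℕ → 𝕜)) k l) (𝓝[>] 0) (𝓝 0) := by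
  have h := (hasDerivAt_iff_tendsto_slope.1 (hasDerivAt_semiKer (σ := σ) hm k l))
  have hc : Tendsto (fun t : ℝ≥0 => (t : ℝ)) (𝓝[>] 0) (𝓝[≠] 0) := by
    refine tendsto_nhdsWithin_iff.2 ⟨?_, ?_⟩
    · exact (NNReal.continuous_coe.tendsto' 0 0 rfl).mono_left nhdsWithin_le_nhds
    · filter_upwards [self_mem_nhdsWithin] with t ht
      exact (NNReal.coe_pos.2 ht).ne'
  have h2 := ((RCLike.continuous_ofReal (K := 𝕜)).tendsto _).comp (h.comp hc)
  rw [← tendsto_sub_nhds_zero_iff] at h2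
  refine h2.congr fun t => ?_
  simp only [Function.comp_apply, slope_def_module, sub_zero, Pi.sub_apply, Pi.smul_apply,
    smul_eq_mul]
  congr 1
  · rw [RCLike.ofReal_mul, RCLike.ofReal_inv, RCLike.ofReal_sub]
    congr 2
    rcases l with _ | l <;> simp [diagKer]
  · rcases l with _ | _ | l
    · simp [genKer_zero]
    · simp [genKer_one]
    · simp [genKer_of_two_le]

/-- The difference quotients of the kernel of `T̂(t)` are bounded from `L_{2C}` to `L_C` uniformly
in `t`, so they can be passed to the limit by dominated convergence. -/
theorem kerWeight_slope_semiKer_le (hm : 0 < m) (hσ : 0 ≤ σ) (hC : 0 < C) (hCσ : σ / m ≤ C)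
    {t : ℝ} (ht : 0 < t) (N : ℕ) :
    kerWeight ((((t : ℝ) : 𝕜)⁻¹) • (semiKer 𝕜 m σ t - diagKer 1)) C N ≤
      (m + σ / C) * (2 * C) ^ N := by
  have h1 := one_sub_exp_nonneg (s := t * m) (by positivity)
  have hct : σ / m * (1 - Real.exp (-(t * m))) ≤ σ * t := by
    have := Real.add_one_le_exp (-(t * m))
    calc σ / m * (1 - Real.exp (-(t * m))) ≤ σ / m * (t * m) := by gcongr; linarith
      _ = σ * t := by field_simp
  have hct' : σ / m * (1 - Real.exp (-(t * m))) ≤ C := by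
    refine le_trans (mul_le_of_le_one_right (by positivity) ?_) hCσ
    have := Real.exp_pos (-(t * m)); linarith
  have hk : ∀ k l : ℕ, ‖((((t : ℝ) : 𝕜)⁻¹) • (semiKer 𝕜 m σ t - diagKer 1) : ℕ → ℕ → 𝕜) k l‖ ≤
      ‖diagKer (fun k => ((m * k : ℝ) : 𝕜)) k l‖ + σ / C * C ^ l := by
    intro k l
    simp only [Pi.smul_apply, Pi.sub_apply, norm_smul, norm_inv, RCLike.norm_ofReal,
      abs_of_pos ht]
    rw [inv_mul_le_iff₀ ht]
    -- For `l = 0` the quotient is at most `m k`; for `l ≥ 1` one factor is at most `σ t`, and the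
    -- others are at most `C`.
    rcases l with _ | l
    · have he : Real.exp (-(t * m * k)) ≤ 1 := by
        rw [Real.exp_le_one_iff, neg_nonpos]; positivity
      have h := Real.add_one_le_exp (-(t * m * k))
      simp only [semiKer, diagKer, if_true, Pi.one_apply, pow_zero, mul_one]
      rw [← RCLike.ofReal_one, ← RCLike.ofReal_sub, RCLike.norm_ofReal, RCLike.norm_ofReal,
        abs_of_nonpos (by linarith), abs_of_nonneg (by positivity)]
      have : 0 ≤ t * (σ / C) := by positivity
      nlinarith
    · simp only [semiKer, diagKer, Nat.add_eq_zero_iff, one_ne_zero, and_false, if_false, sub_zero,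
        norm_zero, zero_add]
      have he : Real.exp (-(t * m * k)) ≤ 1 := by
        rw [Real.exp_le_one_iff, neg_nonpos]; positivity
      rw [RCLike.norm_ofReal, abs_of_nonneg (by positivity), pow_succ]
      calc _ ≤ 1 * (C ^ l * (σ * t)) := by gcongr
        _ = _ := by field_simp; ring
  refine (kerWeight_le_of_norm_le hC.le hk N).trans ?_
  simp only [add_mul, mul_assoc, mul_comm (C ^ _) (C ^ _)]
  rw [binomSum_add, binomSum_const_mul, binomSum_pow_mul_pow, ← two_mul]
  gcongr
  refine (kerWeight_diagKer (fun k => ((m * k : ℝ) : 𝕜)) C N).trans_le ?_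
  rw [RCLike.norm_ofReal, abs_of_nonneg (by positivity), mul_pow, ← mul_assoc]
  gcongr
  exact cast_le_two_pow N

end ConcreteKernels

end FinConf

namespace FinConf

/-! ### The kernel of the resolvent -/

section Resolvent

variable {𝕜 : Type*} [RCLike 𝕜] {m σ C : ℝ} {z : 𝕜}

theorem re_add_natCast (z : 𝕜) (m : ℝ) (k j : ℕ) :
    RCLike.re (z + m * (k + j)) = RCLike.re z + m * (k + j) := by
  have : (m : 𝕜) * (k + j) = ((m * (k + j) : ℝ) : 𝕜) := by push_cast; ring
  rw [this, map_add, RCLike.ofReal_re]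

theorem add_natCast_ne_zero (hm : 0 ≤ m) (hz : 0 < RCLike.re z) (k j : ℕ) :
    z + m * (k + j) ≠ 0 := fun h => by
  have := re_add_natCast z m k j
  rw [h, map_zero] at this
  have : 0 ≤ m * (k + j) := by positivity
  linarith

theorem prod_ne_zero (hm : 0 ≤ m) (hz : 0 < RCLike.re z) (k l : ℕ) :
    ∏ j ∈ Finset.range l, (z + m * (k + j)) ≠ 0 :=
  Finset.prod_ne_zero_iff.2 fun j _ => add_natCast_ne_zero hm hz k j

theorem mul_resKer_zero (hm : 0 ≤ m) (hz : 0 < RCLike.re z) (k : ℕ) :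
    (z + m * k) * resKer m σ z k 0 = 1 := by
  have := add_natCast_ne_zero hm hz k 0
  rw [Nat.cast_zero, add_zero] at this
  simp [resKer, this]

theorem mul_resKer_succ_left (hm : 0 ≤ m) (hz : 0 < RCLike.re z) (k l : ℕ) :
    (z + m * k) * resKer m σ z k (l + 1) = σ * (l + 1) * resKer m σ z (k + 1) l := by
  have h0 := add_natCast_ne_zero hm hz k 0
  rw [Nat.cast_zero, add_zero] at h0
  have h1 := prod_ne_zero hm hz (k + 1) (l + 1)
  have e : ∏ j ∈ Finset.range (l + 1 + 1), (z + m * (k + j)) =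
      (∏ j ∈ Finset.range (l + 1), (z + m * ((k + 1 : ℕ) + j))) * (z + m * k) := by
    rw [Finset.prod_range_succ']
    congr 1
    · exact Finset.prod_congr rfl fun j _ => by push_cast; ring
    · simp
  rw [resKer, resKer, e, Nat.factorial_succ]
  push_cast at h1 ⊢
  field_simp
  ring

theorem mul_resKer_succ_right (hm : 0 ≤ m) (hz : 0 < RCLike.re z) (k l : ℕ) :
    (z + m * (k + (l + 1))) * resKer m σ z k (l + 1) = σ * (l + 1) * resKer m σ z k l := by
  have h0 := add_natCast_ne_zero hm hz k (l + 1)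
  have h1 := prod_ne_zero hm hz k (l + 1)
  rw [resKer, resKer, Finset.prod_range_succ _ (l + 1), Nat.factorial_succ]
  push_cast at h0 h1 ⊢
  field_simp
  ring

/-- On kernels, `(z - L̂) R_z = 1`. -/
theorem kerComp_genKer_resKer (hm : 0 ≤ m) (hz : 0 < RCLike.re z) :
    kerComp (genKer 𝕜 m σ) (resKer m σ z) = z • resKer m σ z - diagKer 1 := by
  funext k l
  rw [kerComp]
  rcases l with _ | l
  · have h := mul_resKer_zero (σ := σ) hm hz k
    rw [binomSum_zero, genKer_zero]
    simp only [Pi.sub_apply, Pi.smul_apply, smul_eq_mul, diagKer, if_true, Pi.one_apply, add_zero]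
    push_cast
    linear_combination -h
  · have h := mul_resKer_succ_left (σ := σ) hm hz k l
    rw [binomSum_eq_of_left_le_one fun i j hi => by rw [genKer_of_two_le k hi, zero_mul],
      genKer_zero, genKer_one]
    simp only [Pi.sub_apply, Pi.smul_apply, smul_eq_mul, diagKer, Nat.add_eq_zero_iff, one_ne_zero,
      and_false, if_false, add_zero]
    push_cast
    linear_combination -h

/-- On kernels, `R_z (z - L̂) = 1`. -/
theorem kerComp_resKer_genKer (hm : 0 ≤ m) (hz : 0 < RCLike.re z) :
    kerComp (resKer m σ z) (genKer 𝕜 m σ) = z • resKer m σ z - diagKer 1 := by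
  funext k l
  rw [kerComp]
  rcases l with _ | l
  · have h := mul_resKer_zero (σ := σ) hm hz k
    rw [binomSum_zero, genKer_zero]
    simp only [Pi.sub_apply, Pi.smul_apply, smul_eq_mul, diagKer, if_true, Pi.one_apply, add_zero]
    push_cast
    linear_combination -h
  · have h := mul_resKer_succ_right (σ := σ) hm hz k l
    rw [binomSum_eq_of_right_le_one fun i j hj => by rw [genKer_of_two_le _ hj, mul_zero],
      genKer_zero, genKer_one]
    simp only [Pi.sub_apply, Pi.smul_apply, smul_eq_mul, diagKer, Nat.add_eq_zero_iff, one_ne_zero,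
      and_false, if_false]
    push_cast
    linear_combination -h

/-- For `σ = m` the binomial sums of the resolvent kernel do not depend on the number of points:
multiplied by `x + m k`, the kernel satisfies the recurrence `mul_resKer_succ_left`, whose two sides
cancel in the sum up to the term of the whole configuration. -/
theorem mul_binomSum_resKer {x : ℝ} (hm : 0 ≤ m) (hx : 0 < x) (N : ℕ) :
    x * binomSum (resKer m m x) N = 1 := by
  have hz : 0 < RCLike.re x := hx
  have h0 : ∀ k, (x + m * k) * resKer m m x k 0 = 1 := mul_resKer_zero hm hz
  have h1 : ∀ k l, (x + m * k) * resKer m m x k (l + 1) = m * (l + 1) * resKer m m x (k + 1) l :=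
    mul_resKer_succ_left hm hz
  rcases N with _ | N
  · rw [binomSum_zero]
    simpa using h0 0
  · have hA : ∑ p ∈ Finset.HasAntidiagonal.antidiagonal (N + 1),
        ((N + 1).choose p.1 : ℝ) * ((x + m * p.1) * resKer m m x p.1 p.2) =
        1 + ∑ p ∈ Finset.HasAntidiagonal.antidiagonal N,
          ((N + 1).choose p.1 : ℝ) * (m * (p.2 + 1) * resKer m m x (p.1 + 1) p.2) := by
      rw [Finset.Nat.antidiagonal_succ', Finset.sum_cons, Finset.sum_map]
      congr 1
      · simp only [h0]; simp
      · exact Finset.sum_congr rfl fun p _ => by rw [← h1]; rfl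
    have hB : ∑ p ∈ Finset.HasAntidiagonal.antidiagonal (N + 1),
        ((N + 1).choose p.1 : ℝ) * (m * p.1 * resKer m m x p.1 p.2) =
        ∑ p ∈ Finset.HasAntidiagonal.antidiagonal N,
          ((N + 1).choose p.1 : ℝ) * (m * (p.2 + 1) * resKer m m x (p.1 + 1) p.2) := by
      rw [Finset.Nat.antidiagonal_succ, Finset.sum_cons, Finset.sum_map]
      simp only [Nat.cast_zero, mul_zero, zero_mul, zero_add]
      refine Finset.sum_congr rfl fun p hp => ?_
      have hp' := Finset.HasAntidiagonal.mem_antidiagonal.1 hp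
      have h := Nat.choose_succ_right_eq (N + 1) p.1
      rw [show N + 1 - p.1 = p.2 + 1 by omega] at h
      have h' : ((N + 1).choose (p.1 + 1) : ℝ) * (p.1 + 1) = (N + 1).choose p.1 * (p.2 + 1) := by
        exact_mod_cast h
      change ((N + 1).choose (p.1 + 1) : ℝ) * (m * ((p.1 + 1 : ℕ) : ℝ) * resKer m m x (p.1 + 1) p.2) = _
      push_cast
      linear_combination m * resKer m m x (p.1 + 1) p.2 * h'
    have hAB := congrArg₂ (· - ·) hA hB
    simp only [← Finset.sum_sub_distrib, add_sub_cancel_right] at hAB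
    rw [binomSum, Finset.mul_sum, ← hAB]
    exact Finset.sum_congr rfl fun p _ => by ring

theorem norm_resKer_le (hm : 0 < m) (hσ : 0 ≤ σ) (hz : 0 < RCLike.re z) (k l : ℕ) :
    ‖resKer m σ z k l‖ ≤ (σ / m) ^ l * resKer m m (RCLike.re z) k l := by
  have hpos : ∀ j : ℕ, 0 < RCLike.re z + m * (k + j) := fun j => by positivity
  have e : (σ / m) ^ l * resKer m m (RCLike.re z) k l =
      σ ^ l * l.factorial / ∏ j ∈ Finset.range (l + 1), (RCLike.re z + m * (k + j)) := by
    simp only [resKer, RCLike.ofReal_real_eq_id, id_eq]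
    rw [← mul_div_assoc, ← mul_assoc, ← mul_pow, div_mul_cancel₀ _ hm.ne']
  rw [e, resKer, norm_div, norm_mul, norm_pow, RCLike.norm_ofReal, abs_of_nonneg hσ,
    RCLike.norm_natCast, norm_prod]
  refine div_le_div_of_nonneg_left (by positivity) (Finset.prod_pos fun j _ => hpos j) ?_
  refine Finset.prod_le_prod (fun j _ => (hpos j).le) fun j _ => ?_
  rw [← re_add_natCast]
  exact RCLike.re_le_norm _

/-- The estimate `‖R_z‖ ≤ 1 / Re z` on `L_C`. -/
theorem kerWeight_resKer_le (hm : 0 < m) (hσ : 0 ≤ σ) (hC : 0 < C) (hCσ : σ / m ≤ C)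
    (hz : 0 < RCLike.re z) (N : ℕ) :
    kerWeight (resKer m σ z) C N ≤ (RCLike.re z)⁻¹ * C ^ N := by
  have h := mul_binomSum_resKer hm.le hz N
  rw [← eq_inv_of_mul_eq_one_right h, kerWeight, binomSum, binomSum, Finset.sum_mul]
  refine Finset.sum_le_sum fun p hp => ?_
  have hp' := Finset.HasAntidiagonal.mem_antidiagonal.1 hp
  have hr : 0 ≤ resKer m m (RCLike.re z) p.1 p.2 := by
    have : ∀ j : ℕ, 0 < RCLike.re z + m * (p.1 + j) := fun j => by positivity
    simp only [resKer, RCLike.ofReal_real_eq_id, id_eq]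
    exact div_nonneg (by positivity) (Finset.prod_nonneg fun j _ => (this j).le)
  calc ((N.choose p.1 : ℝ)) * (‖resKer m σ z p.1 p.2‖ * C ^ p.1)
      ≤ N.choose p.1 * ((C ^ p.2 * resKer m m (RCLike.re z) p.1 p.2) * C ^ p.1) := by
        gcongr
        exact (norm_resKer_le hm hσ hz _ _).trans (by gcongr)
    _ = _ := by rw [← hp', pow_add]; ring

theorem kerBound_resKer (hm : 0 < m) (hσ : 0 ≤ σ) (hC : 0 < C) (hCσ : σ / m ≤ C)
    (hz : 0 < RCLike.re z) : KerBound (resKer m σ z) C C :=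
  ⟨_, kerWeight_resKer_le hm hσ hC hCσ hz⟩

theorem resKer_eq_betaIntegral (hm : 0 < m) {z : ℂ} (hz : 0 < z.re) (k l : ℕ) :
    resKer m σ z k l = 1 / (m : ℂ) *
      (((σ / m : ℝ) : ℂ) ^ l * Complex.betaIntegral (z / m + k) (l + 1)) := by
  have hm' : (m : ℂ) ≠ 0 := by exact_mod_cast hm.ne'
  have hre : 0 < (z / m + k).re := by
    rw [Complex.add_re, Complex.div_ofReal_re, Complex.natCast_re]
    positivity
  rw [Complex.betaIntegral_eval_nat_add_one_right hre]
  have e : ∏ j ∈ Finset.range (l + 1), (z + m * (k + j)) =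
      (m : ℂ) ^ (l + 1) * ∏ j ∈ Finset.range (l + 1), (z / m + k + j) := by
    rw [← Finset.card_range (l + 1), ← Finset.prod_const, Finset.card_range,
      ← Finset.prod_mul_distrib]
    exact Finset.prod_congr rfl fun j _ => by field_simp; ring
  have h := prod_ne_zero (z := z) hm.le hz k (l + 1)
  have e' : resKer m σ z k l = (σ : ℂ) ^ l * (l.factorial : ℂ) /
      ∏ j ∈ Finset.range (l + 1), (z + m * (k + j)) := rfl
  have h' : ∏ j ∈ Finset.range (l + 1), (z / m + k + j) ≠ 0 := fun h0 => h (by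
    rw [h0, mul_zero] at e; exact e)
  rw [e', e, Complex.ofReal_div, div_pow, pow_succ]
  generalize ∏ j ∈ Finset.range (l + 1), (z / m + k + j) = P at h'
  have hml : (m : ℂ) ^ l ≠ 0 := pow_ne_zero _ hm'
  generalize (m : ℂ) ^ l = Q at hml
  field_simp

end Resolvent

end FinConf

/-! ### Contraction semigroups -/

/-- A continuous function whose upper right derivative is at most `K` grows at most at the rate `K`. -/
theorem le_add_mul_of_right_slope_le {φ : ℝ≥0 → ℝ} (hφ : Continuous φ) {K : ℝ} {b : ℝ≥0}
    (h : ∀ t < b, ∀ ε > 0, ∀ᶠ s in 𝓝[>] (0 : ℝ≥0), φ (t + s) ≤ φ t + (K + ε) * s) :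
    φ b ≤ φ 0 + K * b := by
  have key := image_le_of_liminf_slope_right_le_deriv_boundary (f := fun t : ℝ => φ t.toNNReal)
    (a := 0) (b := b) (B := fun t => φ 0 + K * t) (B' := fun _ => K)
    (hφ.comp continuous_real_toNNReal).continuousOn (by simp) (by fun_prop)
    (fun x _ => by
      simpa using (((hasDerivAt_id x).const_mul K).const_add (φ 0)).hasDerivWithinAt)
    (fun t ht r hr => Eventually.frequently ?_) (x := b) ⟨b.2, le_rfl⟩
  · simpa using key
  · have hε : 0 < (r - K) / 2 := by linarith
    have h1 := h t.toNNReal (by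
      rw [← NNReal.coe_lt_coe, Real.coe_toNNReal _ ht.1]; exact ht.2) _ hε
    have hc : Tendsto (fun x : ℝ => (x - t).toNNReal) (𝓝[>] t) (𝓝[>] 0) := by
      refine tendsto_nhdsWithin_iff.2 ⟨?_, ?_⟩
      · exact ((by fun_prop : Continuous fun x : ℝ => (x - t).toNNReal).tendsto' t 0
          (by simp)).mono_left nhdsWithin_le_nhds
      · filter_upwards [self_mem_nhdsWithin] with x hx
        exact Real.toNNReal_pos.2 (sub_pos.2 hx)
    filter_upwards [hc.eventually h1, self_mem_nhdsWithin] with x hx hxt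
    have hxt' : 0 < x - t := sub_pos.2 hxt
    rw [← Real.toNNReal_add ht.1 hxt'.le, add_sub_cancel, Real.coe_toNNReal _ hxt'.le] at hx
    rw [slope_def_field, div_lt_iff₀ hxt']
    nlinarith

section Semigroup

variable {𝕜 E : Type*} [RCLike 𝕜] [NormedAddCommGroup E] [NormedSpace 𝕜 E]
  {T T' : ℝ≥0 → E →L[𝕜] E}

theorem mem_generatorGraph_iff {u v : E} : (u, v) ∈ generatorGraph T ↔
    ∀ ε > 0, ∀ᶠ s in 𝓝[>] (0 : ℝ≥0), ‖T s u - u - ((s : ℝ) : 𝕜) • v‖ ≤ ε * s := by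
  change Tendsto (fun t : ℝ≥0 => (((t : ℝ) : 𝕜)⁻¹) • (T t u - u)) (𝓝[>] 0) (𝓝 v) ↔ _
  rw [Metric.nhds_basis_closedBall.tendsto_right_iff]
  refine forall₂_congr fun ε _ => eventually_congr ?_
  filter_upwards [self_mem_nhdsWithin] with s hs
  have hs' : (0 : ℝ) < s := NNReal.coe_pos.2 hs
  have hs0 : ((s : ℝ) : 𝕜) ≠ 0 := RCLike.ofReal_ne_zero.2 hs'.ne'
  have e : T s u - u - ((s : ℝ) : 𝕜) • v =
      ((s : ℝ) : 𝕜) • ((((s : ℝ) : 𝕜)⁻¹) • (T s u - u) - v) := by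
    rw [smul_sub, smul_inv_smul₀ hs0]
  rw [mem_closedBall_iff_norm, e, norm_smul, RCLike.norm_ofReal, abs_of_pos hs', mul_comm,
    mul_le_mul_iff_left₀ hs']

theorem IsC0Semigroup.map_mem_generatorGraph (hT : IsC0Semigroup T) {u v : E}
    (h : (u, v) ∈ generatorGraph T) (t : ℝ≥0) : (T t u, T t v) ∈ generatorGraph T := by
  change Tendsto (fun s : ℝ≥0 => (((s : ℝ) : 𝕜)⁻¹) • (T s (T t u) - T t u)) (𝓝[>] 0) (𝓝 (T t v))
  refine (((T t).continuous.tendsto v).comp h).congr fun s => ?_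
  have e : T s (T t u) = T t (T s u) := by
    have h1 := hT.add s t
    rw [add_comm, hT.add t s] at h1
    exact (DFunLike.congr_fun h1 u).symm
  rw [Function.comp_apply, map_smul, map_sub, e]

/-- A contraction semigroup satisfies `‖T t u - u - t v‖ ≤ t sup_{s ≤ t} ‖T s v - v‖` for
`(u, v)` in the graph of its generator. -/
theorem IsC0Semigroup.norm_sub_sub_smul_le (hT : IsC0Semigroup T) (hc : ∀ t, ‖T t‖ ≤ 1) {u v : E}
    (h : (u, v) ∈ generatorGraph T) {K : ℝ} {t : ℝ≥0} (hK : ∀ s < t, ‖T s v - v‖ ≤ K) :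
    ‖T t u - u - ((t : ℝ) : 𝕜) • v‖ ≤ K * t := by
  have key := le_add_mul_of_right_slope_le
    (φ := fun s : ℝ≥0 => ‖T s u - u - ((s : ℝ) : 𝕜) • v‖) (K := K) (b := t) ?_ ?_
  · simpa [hT.zero] using key
  · have h1 := hT.continuous u
    have h2 : Continuous fun s : ℝ≥0 => ((s : ℝ) : 𝕜) :=
      RCLike.continuous_ofReal.comp NNReal.continuous_coe
    exact ((h1.sub continuous_const).sub (h2.smul continuous_const)).norm
  · intro s hs ε hε
    filter_upwards [mem_generatorGraph_iff.1 h ε hε] with r hr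
    have e : T (s + r) u - u - (((s + r : ℝ≥0) : ℝ) : 𝕜) • v =
        (T s u - u - ((s : ℝ) : 𝕜) • v) + T s (T r u - u - ((r : ℝ) : 𝕜) • v) +
          ((r : ℝ) : 𝕜) • (T s v - v) := by
      rw [hT.add]
      simp only [ContinuousLinearMap.comp_apply, map_sub, map_smul, NNReal.coe_add,
        RCLike.ofReal_add, add_smul, smul_sub]
      abel
    rw [e]
    refine (norm_add₃_le).trans ?_
    have h1 : ‖T s (T r u - u - ((r : ℝ) : 𝕜) • v)‖ ≤ ε * r :=
      ((T s).le_of_opNorm_le (hc s) _).trans (by rwa [one_mul])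
    have h2 : ‖((r : ℝ) : 𝕜) • (T s v - v)‖ ≤ r * K := by
      rw [norm_smul, RCLike.norm_ofReal, abs_of_nonneg r.coe_nonneg]
      exact mul_le_mul_of_nonneg_left (hK s hs) r.2
    linarith

/-- The generator of a contraction semigroup is closed: `T t u - u - t v` is small compared to `t`
uniformly for the `(u, v)` in the graph near a given point. -/
theorem IsC0Semigroup.isClosed_generatorGraph (hT : IsC0Semigroup T) (hc : ∀ t, ‖T t‖ ≤ 1) :
    IsClosed (generatorGraph T : Set (E × E)) := by
  refine isClosed_of_closure_subset fun p hp => ?_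
  obtain ⟨x, y⟩ := p
  refine mem_generatorGraph_iff.2 fun ε hε => ?_
  have hy : ∀ᶠ s in 𝓝 (0 : ℝ≥0), ‖T s y - y‖ < ε / 3 := by
    have h1 : Tendsto (fun s => ‖T s y - y‖) (𝓝 0) (𝓝 0) := by
      have := ((hT.continuous y).sub continuous_const).norm.tendsto' (y := ‖T 0 y - y‖) 0 rfl
      simpa [hT.zero] using this
    exact h1.eventually (gt_mem_nhds (by positivity))
  obtain ⟨δ, hδ, hδy⟩ : ∃ δ > 0, ∀ s < δ, ‖T s y - y‖ < ε / 3 := by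
    obtain ⟨δ, hδ, h⟩ := (nhds_bot_basis (α := ℝ≥0)).eventually_iff.1 hy
    exact ⟨δ, hδ, fun s hs => h hs⟩
  filter_upwards [nhdsWithin_le_nhds (gt_mem_nhds hδ)] with t ht
  -- The estimate holds on the part of the graph near `(x, y)`, and is a closed condition.
  have hcl : IsClosed {q : E × E | ‖T t q.1 - q.1 - ((t : ℝ) : 𝕜) • q.2‖ ≤ ε * t} :=
    isClosed_le (by fun_prop) continuous_const
  have hopen : IsOpen {q : E × E | ‖q.2 - y‖ < ε / 3} := isOpen_lt (by fun_prop) continuous_const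
  have hxy : (x, y) ∈ {q : E × E | ‖q.2 - y‖ < ε / 3} := by
    change ‖y - y‖ < ε / 3
    rw [sub_self, norm_zero]; positivity
  refine closure_minimal ?_ hcl (hopen.inter_closure ⟨hxy, hp⟩)
  rintro ⟨u, v⟩ ⟨hv, huv⟩
  refine hT.norm_sub_sub_smul_le hc huv fun s hs => ?_
  have hv' : ‖v - y‖ < ε / 3 := hv
  have e : T s v - v = T s (v - y) + (T s y - y) - (v - y) := by rw [map_sub]; abel
  have h1 : ‖T s (v - y)‖ ≤ ‖v - y‖ := by simpa using (T s).le_of_opNorm_le (hc s) (v - y)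
  have h2 := hδy s (hs.trans ht)
  rw [e]
  refine (norm_sub_le _ _).trans ?_
  have h3 := norm_add_le (T s (v - y)) (T s y - y)
  linarith

/-- The generator of a contraction semigroup has no eigenvalue in the right half-plane. -/
theorem generatorGraph_eq_zero (hc : ∀ t, ‖T t‖ ≤ 1) {z : 𝕜} (hz : 0 < RCLike.re z) {u : E}
    (h : (u, z • u) ∈ generatorGraph T) : u = 0 := by
  have key : ∀ ε > 0, RCLike.re z * ‖u‖ ≤ ε := fun ε hε => by
    obtain ⟨s, hs, hs'⟩ := ((mem_generatorGraph_iff.1 h ε hε).and self_mem_nhdsWithin).exists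
    have hs0 : (0 : ℝ) < s := NNReal.coe_pos.2 hs'
    have h1 : ‖(1 + ((s : ℝ) : 𝕜) * z) • u‖ ≤ ‖u‖ + ε * s := by
      have e : (1 + ((s : ℝ) : 𝕜) * z) • u = T s u - (T s u - u - ((s : ℝ) : 𝕜) • z • u) := by
        rw [add_smul, one_smul, mul_smul]; abel
      rw [e]
      refine (norm_sub_le _ _).trans (add_le_add ?_ hs)
      simpa using (T s).le_of_opNorm_le (hc s) u
    have h2 : 1 + s * RCLike.re z ≤ ‖1 + ((s : ℝ) : 𝕜) * z‖ := by
      refine le_trans (le_of_eq ?_) (RCLike.re_le_norm _)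
      simp
    rw [norm_smul] at h1
    have h3 := mul_le_mul_of_nonneg_right h2 (norm_nonneg u)
    have h4 : s * (RCLike.re z * ‖u‖) ≤ s * ε := by linarith
    exact le_of_mul_le_mul_left h4 hs0
  have h0 : RCLike.re z * ‖u‖ ≤ 0 := le_of_forall_pos_le_add fun ε hε => by
    simpa using key ε hε
  exact norm_le_zero_iff.1 (nonpos_of_mul_nonpos_right h0 hz)

/-- A contraction semigroup is determined among all strongly continuous semigroups by its generator:
along an orbit in the domain, the distance of the two semigroups has nonpositive right derivative. -/
theorem IsC0Semigroup.eq_of_generatorGraph_eq (hT : IsC0Semigroup T) (hc : ∀ t, ‖T t‖ ≤ 1)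
    (hT' : IsC0Semigroup T') (h : generatorGraph T' = generatorGraph T)
    (hd : Dense {u : E | ∃ v, (u, v) ∈ generatorGraph T}) : T' = T := by
  funext t
  refine ContinuousLinearMap.ext fun x => ?_
  refine congrFun (Continuous.ext_on hd (T' t).continuous (T t).continuous ?_) x
  rintro u ⟨v, huv⟩
  have key := le_add_mul_of_right_slope_le (φ := fun s => ‖T' s u - T s u‖) (K := 0) (b := t)
    ((hT'.continuous u).sub (hT.continuous u)).norm ?_
  · simpa [hT.zero, hT'.zero, sub_eq_zero] using key
  intro s _ ε hε
  have hw' := hT'.map_mem_generatorGraph (h ▸ huv) s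
  have hw : (T' s u, T' s v) ∈ generatorGraph T := h ▸ hw'
  filter_upwards [mem_generatorGraph_iff.1 hw' (ε / 2) (by positivity),
    mem_generatorGraph_iff.1 hw (ε / 2) (by positivity)] with r h1 h2
  have e : T' (s + r) u - T (s + r) u =
      (T' r (T' s u) - T' s u - ((r : ℝ) : 𝕜) • T' s v) -
        (T r (T' s u) - T' s u - ((r : ℝ) : 𝕜) • T' s v) + T r (T' s u - T s u) := by
    rw [add_comm s r, hT.add, hT'.add]
    simp only [ContinuousLinearMap.comp_apply, map_sub]
    abel
  have h3 : ‖T r (T' s u - T s u)‖ ≤ ‖T' s u - T s u‖ := by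
    simpa using (T r).le_of_opNorm_le (hc r) (T' s u - T s u)
  rw [e]
  refine (norm_add_le _ _).trans ?_
  have h4 := norm_sub_le (T' r (T' s u) - T' s u - ((r : ℝ) : 𝕜) • T' s v)
    (T r (T' s u) - T' s u - ((r : ℝ) : 𝕜) • T' s v)
  linarith

/-! ### Resolvents of closures -/

/-- A bounded operator that inverts `z - A` on both sides, on the left on the graph of `A` and on the
right on a dense set, is the resolvent of the closure of `A`. -/
theorem isResolvent_closure {A : E →ₗ.[𝕜] E} (hA : A.IsClosable) {z : 𝕜} {R : E →L[𝕜] E}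
    {D : Set E} (hD : Dense D) (h1 : ∀ y ∈ D, (R y, z • R y - y) ∈ A.graph)
    (h2 : ∀ p ∈ A.graph, R (z • p.1 - p.2) = p.1) :
    IsResolvent A.closure z R := by
  have hg : (A.closure.graph : Set (E × E)) = closure (A.graph : Set (E × E)) := by
    rw [← hA.graph_closure_eq_closure_graph, Submodule.topologicalClosure_coe]
  have hmem : ∀ y, (R y, z • R y - y) ∈ A.closure.graph := fun y => by
    have hy : y ∈ closure D := hD y
    have := map_mem_closure (f := fun y => (R y, z • R y - y)) (by fun_prop) hy h1
    rwa [← hg] at this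
  constructor
  · intro y
    obtain ⟨x, hx, hx'⟩ := A.closure.mem_graph_iff.1 (hmem y)
    have hdom : R y ∈ A.closure.domain := by
      have hx' : (x : E) = R y := hx
      rw [← hx']; exact x.2
    refine ⟨hdom, ?_⟩
    have : x = ⟨R y, hdom⟩ := Subtype.ext hx
    rw [← this, hx']
    simp
  · intro x
    have hcl : IsClosed {p : E × E | R (z • p.1 - p.2) = p.1} :=
      isClosed_eq (by fun_prop) (by fun_prop)
    have := closure_minimal (s := (A.graph : Set (E × E))) h2 hcl
    rw [← hg] at this
    exact this (A.closure.mem_graph x)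

/-- If the generator of a contraction semigroup extends `A`, and the closure of `A` has a resolvent
in the right half-plane, then the closure of `A` is the whole generator. -/
theorem IsC0Semigroup.generator_eq_closure (hT : IsC0Semigroup T) (hc : ∀ t, ‖T t‖ ≤ 1)
    {A : E →ₗ.[𝕜] E} (hA : A.IsClosable) (hAT : A.graph ≤ generatorGraph T) {z : 𝕜}
    (hz : 0 < RCLike.re z) {R : E →L[𝕜] E} (hR : IsResolvent A.closure z R) :
    generator T = A.closure := by
  have hle : A.closure.graph ≤ generatorGraph T := by
    rw [← hA.graph_closure_eq_closure_graph]
    exact Submodule.topologicalClosure_minimal _ hAT (hT.isClosed_generatorGraph hc)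
  refine LinearPMap.eq_of_eq_graph ?_
  rw [generator_graph]
  refine le_antisymm ?_ hle
  rintro ⟨x, y⟩ hxy
  obtain ⟨w, hw, hRw⟩ : ∃ w, (R (z • x - y), w) ∈ A.closure.graph ∧
      z • R (z • x - y) - w = z • x - y := by
    obtain ⟨hdom, h⟩ := hR.1 (z • x - y)
    exact ⟨_, A.closure.mem_graph ⟨R (z • x - y), hdom⟩, h⟩
  -- `x'` is the point of the domain of the closure with `(z - A) x' = z x - y`; by the injectivity
  -- of `z` minus the generator it equals `x`.
  generalize R (z • x - y) = x' at hw hRw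
  have hsub := (generatorGraph T).sub_mem hxy (hle hw)
  have e : y - w = z • (x - x') := by
    rw [smul_sub, sub_eq_sub_iff_add_eq_add]
    rw [sub_eq_sub_iff_add_eq_add] at hRw
    rw [add_comm y, hRw]
  rw [Prod.mk_sub_mk, e] at hsub
  have h0 := sub_eq_zero.1 (generatorGraph_eq_zero hc hz hsub)
  rw [h0, sub_self, smul_zero, sub_eq_zero] at e
  rwa [h0, e]

end Semigroup

namespace FinConf

variable {d : ℕ} [NeZero d] {𝕜 : Type*} [RCLike 𝕜] {m σ C : ℝ}

/-! ### The operator `L̂` -/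

/-- On `L_{2C}` the expression `L̂` is the operator with kernel `genKer`. -/
theorem hatLFun_eq_kerOp (hm : 0 ≤ m) (hC : 0 < C) {G : FinConf d → 𝕜}
    (hG : MemLp G 1 (lebesguePoissonC d (2 * C))) :
    ∀ᵐ η ∂(lebesguePoisson d), Integrable (fun x : EuclideanSpace ℝ (Fin d) => G (η ∪ {x})) ∧
      hatLFun m σ G η = kerOp (genKer 𝕜 m σ) G η := by
  have hC2 : 0 < 2 * C := by positivity
  filter_upwards [ae_integrable_ker hC hC2 (kerBound_onePointKer hC) hG,
    kerOp_add_ker hC hC2 (kerBound_diagKer_linear hm hC)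
      ((kerBound_onePointKer hC).smul (σ : 𝕜)) hG] with η h1 h2
  obtain ⟨h3, h4⟩ := integrable_union_singleton h1
  refine ⟨h3, ?_⟩
  rw [genKer, h2, Pi.add_apply, kerOp_diagKer, kerOp_smul_ker, Pi.smul_apply, h4, hatLFun,
    RCLike.real_smul_eq_coe_mul, RCLike.real_smul_eq_coe_mul, smul_eq_mul]

theorem mem_hatLGraph_iff (hm : 0 ≤ m) (hC : 0 < C) {p : SpaceLC 𝕜 d C × SpaceLC 𝕜 d C} :
    p ∈ hatLGraph 𝕜 d m σ C ↔ MemLp p.1 1 (lebesguePoissonC d (2 * C)) ∧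
      p.2 =ᵐ[lebesguePoisson d] kerOp (genKer 𝕜 m σ) p.1 := by
  have hC2 : 0 < 2 * C := by positivity
  constructor
  · rintro ⟨g, hg, h1, -, h2⟩
    rw [aeEq_iff_lebesguePoissonC hC] at h1 h2
    refine ⟨hg.ae_eq ((aeEq_iff_lebesguePoissonC hC2).2 h1.symm), ?_⟩
    refine h2.trans (.trans ?_ (kerOp_congr _ h1.symm))
    filter_upwards [hatLFun_eq_kerOp (σ := σ) hm hC hg] with η hη using hη.2
  · rintro ⟨h1, h2⟩
    have h := hatLFun_eq_kerOp (σ := σ) hm hC h1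
    refine ⟨p.1, h1, .rfl, (ae_iff_lebesguePoissonC hC).2 (h.mono fun η hη => hη.1),
      (aeEq_iff_lebesguePoissonC hC).2 ?_⟩
    filter_upwards [h, h2] with η hη hη2
    rw [hη2, hη.2]

/-- The product of `2^{-|η|}` and `L̂` is bounded on `L_C`. -/
theorem dampedGenKer_eq {p : SpaceLC 𝕜 d C × SpaceLC 𝕜 d C} (hm : 0 ≤ m) (hC : 0 < C)
    (hp : p ∈ hatLGraph 𝕜 d m σ C) :
    kerCLM d hC (kerBound_dampedGenKer (𝕜 := 𝕜) (σ := σ) hm hC) p.1 =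
      kerCLM d hC (kerBound_diagKer_inv_two_pow (𝕜 := 𝕜) hC.le) p.2 := by
  have h := ((mem_hatLGraph_iff hm hC).1 hp).2
  refine spaceLC_ext hC ((kerCLM_coe hC _ _).trans (.trans ?_ (kerCLM_coe hC _ _).symm))
  filter_upwards [h] with η hη
  rw [kerOp_diagKer, hη]
  exact kerOp_mul_left (fun k => (2⁻¹ : 𝕜) ^ k) (genKer 𝕜 m σ) p.1 η

/-- The closure of the graph of `L̂` is a graph, since `2^{-|η|} L̂` is bounded on `L_C`. -/
theorem eq_zero_of_mem_closure_hatLGraph (hm : 0 ≤ m) (hC : 0 < C)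
    {p : SpaceLC 𝕜 d C × SpaceLC 𝕜 d C} (hp : p ∈ (hatLGraph 𝕜 d m σ C).topologicalClosure)
    (h0 : p.1 = 0) : p.2 = 0 := by
  have hcl : IsClosed {p : SpaceLC 𝕜 d C × SpaceLC 𝕜 d C |
      kerCLM d hC (kerBound_dampedGenKer (𝕜 := 𝕜) (σ := σ) hm hC) p.1 =
        kerCLM d hC (kerBound_diagKer_inv_two_pow (𝕜 := 𝕜) hC.le) p.2} :=
    isClosed_eq (by fun_prop) (by fun_prop)
  have h : kerCLM d hC (kerBound_dampedGenKer (𝕜 := 𝕜) (σ := σ) hm hC) p.1 =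
      kerCLM d hC (kerBound_diagKer_inv_two_pow (𝕜 := 𝕜) hC.le) p.2 :=
    closure_minimal (fun q hq => dampedGenKer_eq hm hC hq) hcl hp
  rw [h0, map_zero] at h
  have h1 := kerCLM_coe hC (kerBound_diagKer_inv_two_pow (𝕜 := 𝕜) hC.le) p.2
  rw [← h] at h1
  refine spaceLC_ext hC ?_
  have hz := (aeEq_iff_lebesguePoissonC hC).1 (Lp.coeFn_zero 𝕜 1 (lebesguePoissonC d C))
  filter_upwards [h1, hz] with η hη hz
  rw [hz, Pi.zero_apply, kerOp_diagKer] at hη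
  rw [hz, Pi.zero_apply]
  exact (mul_eq_zero.1 hη.symm).resolve_left (pow_ne_zero _ (by norm_num))

theorem hatL_graph (hm : 0 ≤ m) (hC : 0 < C) :
    (hatL 𝕜 d m σ C).graph = hatLGraph 𝕜 d m σ C :=
  Submodule.toLinearPMap_graph_eq _ fun _ hp h0 =>
    eq_zero_of_mem_closure_hatLGraph hm hC (Submodule.le_topologicalClosure _ hp) h0

theorem hatL_isClosable (hm : 0 ≤ m) (hC : 0 < C) : (hatL 𝕜 d m σ C).IsClosable := by
  refine ⟨(hatL 𝕜 d m σ C).graph.topologicalClosure.toLinearPMap, ?_⟩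
  rw [hatL_graph hm hC]
  exact (Submodule.toLinearPMap_graph_eq _ fun _ hp h0 =>
    eq_zero_of_mem_closure_hatLGraph hm hC hp h0).symm

theorem mem_hatL_domain_iff (hm : 0 ≤ m) (hC : 0 < C) {x : SpaceLC 𝕜 d C} :
    x ∈ (hatL 𝕜 d m σ C).domain ↔ MemLp x 1 (lebesguePoissonC d (2 * C)) := by
  rw [LinearPMap.mem_domain_iff, hatL_graph hm hC]
  constructor
  · rintro ⟨y, hy⟩
    exact ((mem_hatLGraph_iff hm hC).1 hy).1
  · intro hx
    have hk := memLp_kerOp hC (by positivity) (kerBound_genKer (σ := σ) hm hC) hx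
    exact ⟨hk.toLp _, (mem_hatLGraph_iff hm hC).2 ⟨hx, coeFn_toLp' hC hk⟩⟩

theorem dense_memLp (hC : 0 < C) :
    Dense {x : SpaceLC 𝕜 d C | MemLp x 1 (lebesguePoissonC d (2 * C))} := fun x => by
  obtain ⟨y, hy, hyx⟩ := exists_tendsto_memLp hC (by linarith : C ≤ 2 * C) x
  exact mem_closure_of_tendsto hyx (.of_forall hy)

/-! ### The resolvent -/

/-- On `L_{2C}`, which it leaves invariant, the operator with the resolvent kernel inverts `z - L̂` on
the right. -/
theorem resKer_mem_hatLGraph (hm : 0 < m) (hσ : 0 ≤ σ) (hC : 0 < C) (hCσ : σ / m ≤ C) {z : 𝕜}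
    (hz : 0 < RCLike.re z) {y : SpaceLC 𝕜 d C} (hy : MemLp y 1 (lebesguePoissonC d (2 * C))) :
    (kerCLM d hC (kerBound_resKer hm hσ hC hCσ hz) y,
      z • kerCLM d hC (kerBound_resKer hm hσ hC hCσ hz) y - y) ∈ hatLGraph 𝕜 d m σ C := by
  have hC2 : 0 < 2 * C := by positivity
  have hb := kerBound_resKer hm hσ hC hCσ hz
  have hb2 := kerBound_resKer hm hσ hC2 (hCσ.trans (by linarith)) hz
  have hR := kerCLM_coe hC hb y
  refine (mem_hatLGraph_iff hm.le hC).2 ⟨?_, ?_⟩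
  · exact (memLp_kerOp hC2 hC2 hb2 hy).ae_eq ((aeEq_iff_lebesguePoissonC hC2).2 hR.symm)
  · refine .trans ?_ (kerOp_congr _ hR.symm)
    refine .trans ?_ (kerOp_kerOp hC hC2 hC2 (kerBound_genKer hm.le hC) hb2 hy).symm
    rw [kerComp_genKer_resKer hm.le hz]
    refine .trans ?_ (kerOp_sub_ker hC hC (hb.smul z) kerBound_diagKer_one (Lp.memLp y)).symm
    rw [kerOp_diagKer_one, kerOp_smul_ker]
    exact (coeFn_sub' hC _ _).trans (((coeFn_smul' hC _ _).trans (hR.const_smul z)).sub .rfl)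

/-- The operator with the resolvent kernel inverts `z - L̂` on the left. -/
theorem kerCLM_resKer_sub (hm : 0 < m) (hσ : 0 ≤ σ) (hC : 0 < C) (hCσ : σ / m ≤ C) {z : 𝕜}
    (hz : 0 < RCLike.re z) {p : SpaceLC 𝕜 d C × SpaceLC 𝕜 d C} (hp : p ∈ hatLGraph 𝕜 d m σ C) :
    kerCLM d hC (kerBound_resKer hm hσ hC hCσ hz) (z • p.1 - p.2) = p.1 := by
  have hC2 : 0 < 2 * C := by positivity
  have hb := kerBound_resKer hm hσ hC hCσ hz
  obtain ⟨h1, h2⟩ := (mem_hatLGraph_iff hm.le hC).1 hp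
  rw [map_sub, map_smul, sub_eq_iff_eq_add, ← sub_eq_iff_eq_add']
  refine spaceLC_ext hC (.symm ?_)
  refine (kerCLM_coe hC hb p.2).trans ((kerOp_congr _ h2).trans ?_)
  refine (kerOp_kerOp hC hC2 hC hb (kerBound_genKer hm.le hC) h1).trans ?_
  rw [kerComp_resKer_genKer hm.le hz]
  refine (kerOp_sub_ker hC hC (hb.smul z) kerBound_diagKer_one (Lp.memLp p.1)).trans ?_
  rw [kerOp_diagKer_one, kerOp_smul_ker]
  exact (((kerCLM_coe hC hb p.1).symm.const_smul z).trans (coeFn_smul' hC _ _).symm).sub .rfl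
    |>.trans (coeFn_sub' hC _ _).symm

theorem isResolvent_kerCLM (d : ℕ) [NeZero d] (hm : 0 < m) (hσ : 0 ≤ σ) (hC : 0 < C)
    (hCσ : σ / m ≤ C) {z : 𝕜} (hz : 0 < RCLike.re z) :
    IsResolvent (hatL 𝕜 d m σ C).closure z (kerCLM d hC (kerBound_resKer hm hσ hC hCσ hz)) := by
  refine isResolvent_closure (hatL_isClosable hm.le hC) (dense_memLp hC) (fun y hy => ?_)
    fun p hp => ?_
  · rw [hatL_graph hm.le hC]
    exact resKer_mem_hatLGraph hm hσ hC hCσ hz hy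
  · rw [hatL_graph hm.le hC] at hp
    exact kerCLM_resKer_sub hm hσ hC hCσ hz hp

/-! ### The semigroup -/

theorem kerBound_semiKer (hm : 0 < m) (hσ : 0 ≤ σ) (hC : 0 < C) (hCσ : σ / m ≤ C) (t : ℝ≥0) :
    KerBound (semiKer 𝕜 m σ t) C C :=
  ⟨1, kerWeight_semiKer_le hm hσ t.coe_nonneg hC.le hCσ⟩

/-- The semigroup generated by the closure of `L̂`. -/
def semiCLM (𝕜 : Type*) [RCLike 𝕜] (d : ℕ) [NeZero d] (hm : 0 < m) (hσ : 0 ≤ σ) (hC : 0 < C)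
    (hCσ : σ / m ≤ C) (t : ℝ≥0) : SpaceLC 𝕜 d C →L[𝕜] SpaceLC 𝕜 d C :=
  kerCLM d hC (kerBound_semiKer hm hσ hC hCσ t)

theorem norm_semiCLM_le (hm : 0 < m) (hσ : 0 ≤ σ) (hC : 0 < C) (hCσ : σ / m ≤ C) (t : ℝ≥0) :
    ‖semiCLM 𝕜 d hm hσ hC hCσ t‖ ≤ 1 :=
  norm_kerCLM_le hC _ zero_le_one (kerWeight_semiKer_le hm hσ t.coe_nonneg hC.le hCσ)

theorem isC0Semigroup_semiCLM (hm : 0 < m) (hσ : 0 ≤ σ) (hC : 0 < C) (hCσ : σ / m ≤ C) :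
    IsC0Semigroup (semiCLM 𝕜 d hm hσ hC hCσ) where
  zero := by
    refine ContinuousLinearMap.ext fun x => spaceLC_ext hC ?_
    refine (kerCLM_coe hC _ x).trans ?_
    rw [NNReal.coe_zero, semiKer_zero, kerOp_diagKer_one]
    rfl
  add s t := by
    refine ContinuousLinearMap.ext fun x => spaceLC_ext hC ?_
    have hs := kerBound_semiKer (𝕜 := 𝕜) hm hσ hC hCσ s
    have ht := kerBound_semiKer (𝕜 := 𝕜) hm hσ hC hCσ t
    refine (kerCLM_coe hC _ x).trans (.trans ?_ (kerCLM_coe hC hs _).symm)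
    refine .trans ?_ (kerOp_congr _ (kerCLM_coe hC ht x).symm)
    refine .trans ?_ (kerOp_kerOp hC hC hC hs ht (Lp.memLp x)).symm
    rw [kerComp_semiKer, NNReal.coe_add]
  continuous x := by
    refine continuous_iff_continuousAt.2 fun t₀ => ?_
    rw [ContinuousAt, ← tendsto_sub_nhds_zero_iff]
    refine tendsto_zero_of_coe_eq_kerOp (a := fun t : ℝ≥0 => semiKer 𝕜 m σ t - semiKer 𝕜 m σ t₀)
      hC hC (M := 2) (.of_forall fun t N => ?_) (fun k l => ?_) (Lp.memLp x)
      (.of_forall fun t => ?_)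
    · refine (kerWeight_sub_le _ _ hC.le N).trans ?_
      have h1 := kerWeight_semiKer_le (𝕜 := 𝕜) hm hσ t.coe_nonneg hC.le hCσ N
      have h2 := kerWeight_semiKer_le (𝕜 := 𝕜) hm hσ t₀.coe_nonneg hC.le hCσ N
      linarith
    · have := (continuous_semiKer (𝕜 := 𝕜) (m := m) (σ := σ) k l).tendsto t₀
      exact tendsto_sub_nhds_zero_iff.2 this
    · have ht := kerBound_semiKer (𝕜 := 𝕜) hm hσ hC hCσ t
      have ht₀ := kerBound_semiKer (𝕜 := 𝕜) hm hσ hC hCσ t₀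
      refine (coeFn_sub' hC _ _).trans (.trans ?_ (kerOp_sub_ker hC hC ht ht₀ (Lp.memLp x)).symm)
      exact (kerCLM_coe hC ht x).sub (kerCLM_coe hC ht₀ x)

theorem hatLGraph_le_generatorGraph (hm : 0 < m) (hσ : 0 ≤ σ) (hC : 0 < C) (hCσ : σ / m ≤ C) :
    hatLGraph 𝕜 d m σ C ≤ generatorGraph (semiCLM 𝕜 d hm hσ hC hCσ) := by
  rintro ⟨x, y⟩ hp
  have hC2 : 0 < 2 * C := by positivity
  obtain ⟨h1, h2⟩ := (mem_hatLGraph_iff hm.le hC).1 hp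
  change Tendsto (fun t : ℝ≥0 => (((t : ℝ) : 𝕜)⁻¹) • (semiCLM 𝕜 d hm hσ hC hCσ t x - x)) (𝓝[>] 0)
    (𝓝 y)
  obtain ⟨M, hM⟩ := kerBound_genKer (𝕜 := 𝕜) (σ := σ) hm.le hC
  rw [← tendsto_sub_nhds_zero_iff]
  refine tendsto_zero_of_coe_eq_kerOp (a := fun t : ℝ≥0 => (((t : ℝ) : 𝕜)⁻¹) •
    (semiKer 𝕜 m σ t - diagKer 1) - genKer 𝕜 m σ) hC hC2 (M := m + σ / C + M) ?_
    (fun k l => tendsto_slope_semiKer hm.ne' k l) h1 ?_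
  · filter_upwards [self_mem_nhdsWithin] with t ht N
    refine (kerWeight_sub_le _ _ hC.le N).trans ?_
    rw [add_mul (m + σ / C)]
    exact add_le_add (kerWeight_slope_semiKer_le hm hσ hC hCσ (NNReal.coe_pos.2 ht) N) (hM N)
  · filter_upwards [self_mem_nhdsWithin] with t ht
    have hb := kerBound_semiKer (𝕜 := 𝕜) hm hσ hC hCσ t
    have hq : KerBound ((((t : ℝ) : 𝕜)⁻¹) • (semiKer 𝕜 m σ t - diagKer 1)) C (2 * C) :=
      ⟨_, kerWeight_slope_semiKer_le hm hσ hC hCσ (NNReal.coe_pos.2 ht)⟩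
    refine (coeFn_sub' hC _ _).trans
      (.trans ?_ (kerOp_sub_ker hC hC2 hq ⟨M, hM⟩ h1).symm)
    refine EventuallyEq.sub ((coeFn_smul' hC _ _).trans ?_) h2
    rw [kerOp_smul_ker]
    refine EventuallyEq.const_smul ((coeFn_sub' hC _ _).trans ?_) _
    refine .trans ?_ (kerOp_sub_ker hC hC hb kerBound_diagKer_one (Lp.memLp x)).symm
    rw [kerOp_diagKer_one]
    exact (kerCLM_coe hC hb x).sub .rfl

theorem generator_semiCLM (hm : 0 < m) (hσ : 0 ≤ σ) (hC : 0 < C) (hCσ : σ / m ≤ C) :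
    generator (semiCLM 𝕜 d hm hσ hC hCσ) = (hatL 𝕜 d m σ C).closure := by
  -- Any point of the right half-plane would do in place of `1`.
  have hz : 0 < RCLike.re (1 : 𝕜) := by simp
  refine (isC0Semigroup_semiCLM hm hσ hC hCσ).generator_eq_closure
    (norm_semiCLM_le hm hσ hC hCσ) (hatL_isClosable hm.le hC) ?_ hz
    (isResolvent_kerCLM d hm hσ hC hCσ hz)
  rw [hatL_graph hm.le hC]
  exact hatLGraph_le_generatorGraph hm hσ hC hCσ

theorem eq_semiCLM_of_generator_eq (hm : 0 < m) (hσ : 0 ≤ σ) (hC : 0 < C) (hCσ : σ / m ≤ C)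
    {T' : ℝ≥0 → SpaceLC 𝕜 d C →L[𝕜] SpaceLC 𝕜 d C} (hT' : IsC0Semigroup T')
    (h : generator T' = (hatL 𝕜 d m σ C).closure) : T' = semiCLM 𝕜 d hm hσ hC hCσ := by
  refine (isC0Semigroup_semiCLM hm hσ hC hCσ).eq_of_generatorGraph_eq
    (norm_semiCLM_le hm hσ hC hCσ) hT' ?_ ((dense_memLp hC).mono fun x hx => ?_)
  · rw [← generator_graph, ← generator_graph, h, generator_semiCLM]
  · rw [Set.mem_ofPred_eq, ← mem_hatL_domain_iff (σ := σ) hm.le hC, LinearPMap.mem_domain_iff,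
      hatL_graph hm.le hC] at hx
    obtain ⟨y, hy⟩ := hx
    exact ⟨y, hatLGraph_le_generatorGraph hm hσ hC hCσ hy⟩

theorem semiCLM_toLp (hm : 0 < m) (hσ : 0 ≤ σ) (hC : 0 < C) (hCσ : σ / m ≤ C) (t : ℝ≥0)
    {G : FinConf d → 𝕜} (hG : MemLp G 1 (lebesguePoissonC d C)) :
    ∀ᵐ η ∂(lebesguePoisson d),
      Integrable (fun ξ => coherent (fun _ => σ / m * (1 - Real.exp (-(t * m)))) ξ •
        G (η ∪ ξ)) (lebesguePoisson d) ∧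
      semiCLM 𝕜 d hm hσ hC hCσ t (hG.toLp G) η = Real.exp (-(t * m * (η.card : ℝ))) •
        ∫ ξ, coherent (fun _ => σ / m * (1 - Real.exp (-(t * m)))) ξ •
          G (η ∪ ξ) ∂(lebesguePoisson d) := by
  have hb := kerBound_semiKer (𝕜 := 𝕜) hm hσ hC hCσ t
  filter_upwards [kerCLM_toLp hC hb hG, ae_integrable_ker hC hC hb hG] with η h1 h2
  have e : ∀ ξ : FinConf d, semiKer 𝕜 m σ t η.card ξ.card * G (η ∪ ξ) =
      ((Real.exp (-(t * m * (η.card : ℝ))) : ℝ) : 𝕜) *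
        (coherent (fun _ => σ / m * (1 - Real.exp (-(t * m)))) ξ • G (η ∪ ξ)) := fun ξ => by
    rw [semiKer, coherent, Finset.prod_const, RCLike.real_smul_eq_coe_mul, RCLike.ofReal_mul,
      mul_assoc]
    rfl
  simp_rw [e] at h2
  have hne : ((Real.exp (-(t * m * (η.card : ℝ))) : ℝ) : 𝕜) ≠ 0 :=
    RCLike.ofReal_ne_zero.2 (Real.exp_pos _).ne'
  refine ⟨(integrable_const_mul_iff hne.isUnit _).1 h2, h1.trans ?_⟩
  rw [kerOp]
  simp_rw [e]
  rw [integral_const_mul, RCLike.real_smul_eq_coe_mul]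

theorem resolvent_toLp (hm : 0 < m) (hσ : 0 ≤ σ) (hC : 0 < C) (hCσ : σ / m ≤ C) {z : ℂ}
    (hz : 0 < z.re) {G : FinConf d → ℂ} (hG : MemLp G 1 (lebesguePoissonC d C)) :
    ∀ᵐ η ∂(lebesguePoisson d),
      Integrable (fun ξ => G (η ∪ ξ) * ((σ / m : ℝ) : ℂ) ^ ξ.card *
        Complex.betaIntegral (z / m + η.card) (ξ.card + 1)) (lebesguePoisson d) ∧
      kerCLM d hC (kerBound_resKer (𝕜 := ℂ) hm hσ hC hCσ hz) (hG.toLp G) η = 1 / (m : ℂ) *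
        ∫ ξ, G (η ∪ ξ) * ((σ / m : ℝ) : ℂ) ^ ξ.card *
          Complex.betaIntegral (z / m + η.card) (ξ.card + 1) ∂(lebesguePoisson d) := by
  have hb := kerBound_resKer (𝕜 := ℂ) hm hσ hC hCσ hz
  filter_upwards [kerCLM_toLp hC hb hG, ae_integrable_ker hC hC hb hG] with η h1 h2
  have e : ∀ ξ : FinConf d, resKer m σ z η.card ξ.card * G (η ∪ ξ) = 1 / (m : ℂ) *
      (G (η ∪ ξ) * ((σ / m : ℝ) : ℂ) ^ ξ.card *
        Complex.betaIntegral (z / m + η.card) (ξ.card + 1)) := fun ξ => by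
    rw [resKer_eq_betaIntegral hm hz]; ring
  simp_rw [e] at h2
  have hne : 1 / (m : ℂ) ≠ 0 := one_div_ne_zero (by exact_mod_cast hm.ne')
  refine ⟨(integrable_const_mul_iff hne.isUnit _).1 h2, h1.trans ?_⟩
  rw [kerOp]
  simp_rw [e]
  rw [integral_const_mul]

theorem hatL_toLp (hm : 0 ≤ m) (hC : 0 < C) {G : FinConf d → 𝕜}
    (hG : MemLp G 1 (lebesguePoissonC d C)) (hdom : hG.toLp G ∈ (hatL 𝕜 d m σ C).domain) :
    ∀ᵐ η ∂(lebesguePoisson d),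
      Integrable (fun x : EuclideanSpace ℝ (Fin d) => G (η ∪ {x})) ∧
      hatL 𝕜 d m σ C ⟨hG.toLp G, hdom⟩ η = hatLFun m σ G η := by
  have hcoe := coeFn_toLp' hC hG
  have hG2 : MemLp G 1 (lebesguePoissonC d (2 * C)) :=
    ((mem_hatL_domain_iff hm hC).1 hdom).ae_eq
      ((aeEq_iff_lebesguePoissonC (by positivity)).2 hcoe)
  have hmem := (hatL 𝕜 d m σ C).mem_graph ⟨hG.toLp G, hdom⟩
  rw [hatL_graph hm hC] at hmem
  filter_upwards [hatLFun_eq_kerOp (σ := σ) hm hC hG2,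
    ((mem_hatLGraph_iff hm hC).1 hmem).2.trans (kerOp_congr _ hcoe)] with η h1 h2
  exact ⟨h1.1, by rw [h1.2]; exact h2⟩

end FinConf

end

theorem mainTheorem7 {𝕜 : Type*} [RCLike 𝕜] (d : ℕ) (hd : 0 < d) (m σ C : ℝ)
    (hm : 0 < m) (hσ : 0 ≤ σ) (hC : 0 < C) (hCσ : σ / m ≤ C) :
    -- the operator with domain `L_{2C}` is well defined, densely defined and closable
    (((hatL 𝕜 d m σ C).domain : Set (SpaceLC 𝕜 d C)) =
        {G : SpaceLC 𝕜 d C | MemLp (G : FinConf d → 𝕜) 1 (FinConf.lebesguePoissonC d (2 * C))} ∧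
      (∀ (G : FinConf d → 𝕜) (hG : MemLp G 1 (FinConf.lebesguePoissonC d C))
        (hdom : hG.toLp G ∈ (hatL 𝕜 d m σ C).domain),
        ∀ᵐ η ∂(FinConf.lebesguePoisson d),
          Integrable (fun x : EuclideanSpace ℝ (Fin d) => G (η ∪ {x})) ∧
          hatL 𝕜 d m σ C ⟨hG.toLp G, hdom⟩ η = hatLFun m σ G η) ∧
      Dense ((hatL 𝕜 d m σ C).domain : Set (SpaceLC 𝕜 d C)) ∧
      (hatL 𝕜 d m σ C).IsClosable) ∧
    -- its closure generates a unique semigroup, which is contractive and explicit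
    (∃ T : ℝ≥0 → SpaceLC 𝕜 d C →L[𝕜] SpaceLC 𝕜 d C,
      IsC0Semigroup T ∧ (∀ t, ‖T t‖ ≤ 1) ∧ generator T = (hatL 𝕜 d m σ C).closure ∧
      (∀ T' : ℝ≥0 → SpaceLC 𝕜 d C →L[𝕜] SpaceLC 𝕜 d C,
        IsC0Semigroup T' → generator T' = (hatL 𝕜 d m σ C).closure → T' = T) ∧
      ∀ (t : ℝ≥0) (G : FinConf d → 𝕜) (hG : MemLp G 1 (FinConf.lebesguePoissonC d C)),
        ∀ᵐ η ∂(FinConf.lebesguePoisson d),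
          Integrable (fun ξ => FinConf.coherent (fun _ => σ / m * (1 - Real.exp (-(t * m)))) ξ •
            G (η ∪ ξ)) (FinConf.lebesguePoisson d) ∧
          T t (hG.toLp G) η = Real.exp (-(t * m * (η.card : ℝ))) •
            ∫ ξ, FinConf.coherent (fun _ => σ / m * (1 - Real.exp (-(t * m)))) ξ •
              G (η ∪ ξ) ∂(FinConf.lebesguePoisson d)) ∧
    -- the resolvent, on the complex space
    (∀ z : ℂ, 0 < z.re →
      ∃ R : SpaceLC ℂ d C →L[ℂ] SpaceLC ℂ d C,
        IsResolvent (hatL ℂ d m σ C).closure z R ∧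
        ∀ (G : FinConf d → ℂ) (hG : MemLp G 1 (FinConf.lebesguePoissonC d C)),
          ∀ᵐ η ∂(FinConf.lebesguePoisson d),
            Integrable (fun ξ => G (η ∪ ξ) * ((σ / m : ℝ) : ℂ) ^ ξ.card *
              Complex.betaIntegral (z / m + η.card) (ξ.card + 1)) (FinConf.lebesguePoisson d) ∧
            R (hG.toLp G) η = 1 / (m : ℂ) *
              ∫ ξ, G (η ∪ ξ) * ((σ / m : ℝ) : ℂ) ^ ξ.card *
                Complex.betaIntegral (z / m + η.card) (ξ.card + 1) ∂(FinConf.lebesguePoisson d)) := by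
  have : NeZero d := ⟨hd.ne'⟩
  refine ⟨⟨?_, ?_, ?_, FinConf.hatL_isClosable hm.le hC⟩, ?_, fun z hz => ?_⟩
  · ext x
    exact FinConf.mem_hatL_domain_iff hm.le hC
  · exact fun G hG hdom => FinConf.hatL_toLp hm.le hC hG hdom
  · exact (FinConf.dense_memLp hC).mono fun x hx => (FinConf.mem_hatL_domain_iff hm.le hC).2 hx
  · exact ⟨FinConf.semiCLM 𝕜 d hm hσ hC hCσ, FinConf.isC0Semigroup_semiCLM hm hσ hC hCσ,
      FinConf.norm_semiCLM_le hm hσ hC hCσ, FinConf.generator_semiCLM hm hσ hC hCσ,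
      fun T' hT' h => FinConf.eq_semiCLM_of_generator_eq hm hσ hC hCσ hT' h,
      fun t G hG => FinConf.semiCLM_toLp hm hσ hC hCσ t hG⟩
  · exact ⟨_, FinConf.isResolvent_kerCLM d hm hσ hC hCσ hz,
      fun G hG => FinConf.resolvent_toLp hm hσ hC hCσ hz hG⟩
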